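/- Let $n\ge 1$ and let $\Omega\subset\mathbb C^n$ be a bounded domain that is biholomorphic to a ball in $\mathbb C^n$. Let $K(z,t)$ be the Bergman kernel of $\Omega$, i.e. the reproducing kernel of the Hilbert space of holomorphic functions on $\Omega$ that are square integrable with respect to Lebesgue measure, and let $g_{\alpha\bar\beta}(p)=\frac{\partial^2}{\partial z_\alpha\partial\bar z_\beta}\big|_{z=p}\log K(z,z)$ be its Bergman metric, with $g^{\bar j\alpha}(p)$ the entries of the inverse of the matrix $[g_{\alpha\bar j}(p)]$. The Bergman representative coordinate $T=(w_1,\dots,w_n)$ relative to $p\in\Omega$ is $$w_\alpha(z)=\sum_{j=1}^n g^{\bar j\alpha}(p)\left(K(z,p)^{-1}\,\frac{\partial}{\partial \bar t_j}\Big|_{t=p}K(z,t)-\frac{\partial}{\partial\bar t_j}\Big|_{t=p}\log K(t,t)\right),\qquad \alpha=1,\dots,n.$$ Assume that there are a nonempty open set $U\subset\Omega$ and finite constants $\mathcal C>0$, $C>0$ such that $$\left|\frac{\partial}{\partial z_j}K(z,p)\right|\le \mathcal C\,|K(z,p)|\quad (j=1,\dots,n)\qquad\text{and}\qquad |K(z,p)|\ge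 C$$ for all $z\in\Omega$ and all $p\in U$. Then for every $p\in U$ the Bergman representative coordinate $T$ relative to $p$ maps $\Omega$ biholomorphically onto the ball $$\mathcal B=\Big\{w\in\mathbb C^n:\ \sum_{\alpha,\beta=1}^n w_\alpha\, g_{\alpha\bar\beta}(p)\,\overline{w_\beta}<n+1\Big\},$$ and its inverse $T^{-1}:\mathcal B\to\Omega$ extends continuously to the closure $\overline{\mathcal B}$. In particular, $\partial\Omega$ is locally connected. -/

import Mathlib

noncomputable section

/-- Square integrable holomorphic functions on the open set `Ω ⊆ ℂⁿ` (elements of the Bergman space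
`A²(Ω)`), with respect to Lebesgue measure; only the values on `Ω` matter. -/
def MemBergmanSpace {n : ℕ} (Ω : Set (Fin n → ℂ)) (f : (Fin n → ℂ) → ℂ) : Prop :=
  DifferentiableOn ℂ f Ω ∧
    MeasureTheory.MemLp f 2 (MeasureTheory.volume.restrict Ω)

/-- `k ∈ A²(Ω)` represents evaluation at `p`: `f(p) = ∫_Ω f(z) conj(k(z)) dV(z)` for all
`f ∈ A²(Ω)`. -/
def IsReproducingAt {n : ℕ} (Ω : Set (Fin n → ℂ)) (p : Fin n → ℂ) (k : (Fin n → ℂ) → ℂ) : Prop :=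
  MemBergmanSpace Ω k ∧
    ∀ f, MemBergmanSpace Ω f → f p = ∫ z in Ω, f z * starRingEnd ℂ (k z)

open Classical in
/-- The Bergman kernel `K(z, p)` of `Ω`: for `p ∈ Ω`, the function `K(·, p)` is the element of
`A²(Ω)` (unique on `Ω`) that represents evaluation at `p`. -/
def bergmanKernel {n : ℕ} (Ω : Set (Fin n → ℂ)) (z p : Fin n → ℂ) : ℂ :=
  if h : ∃ k, IsReproducingAt Ω p k then h.choose z else 0

/-- The Wirtinger derivative `∂f/∂z_j = (∂f/∂x_j - i ∂f/∂y_j) / 2`. -/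
def wirtinger {n : ℕ} (j : Fin n) (f : (Fin n → ℂ) → ℂ) (z : Fin n → ℂ) : ℂ :=
  (fderiv ℝ f z (Pi.single j 1) - Complex.I * fderiv ℝ f z (Pi.single j Complex.I)) / 2

/-- The Wirtinger derivative `∂f/∂z̄_j = (∂f/∂x_j + i ∂f/∂y_j) / 2`. -/
def wirtingerBar {n : ℕ} (j : Fin n) (f : (Fin n → ℂ) → ℂ) (z : Fin n → ℂ) : ℂ :=
  (fderiv ℝ f z (Pi.single j 1) + Complex.I * fderiv ℝ f z (Pi.single j Complex.I)) / 2

/-- The function `t ↦ log K(t, t)` (recall that `K(t, t)` is a positive real number on a bounded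
domain). -/
def logBergmanDiag {n : ℕ} (Ω : Set (Fin n → ℂ)) (t : Fin n → ℂ) : ℂ :=
  (Real.log (bergmanKernel Ω t t).re : ℂ)

/-- The matrix `[g_{α β̄}(p)]`, `g_{α β̄} = ∂² log K(z, z) / ∂z_α ∂z̄_β`, of the Bergman metric. -/
def bergmanMetric {n : ℕ} (Ω : Set (Fin n → ℂ)) (p : Fin n → ℂ) : Matrix (Fin n) (Fin n) ℂ :=
  Matrix.of fun α β => wirtinger α (wirtingerBar β (logBergmanDiag Ω)) p

/-- The Bergman representative coordinate `T = (w_1, …, w_n)` relative to `p`: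
`w_α(z) = ∑_j g^{j̄ α}(p) (K(z,p)⁻¹ ∂/∂t̄_j|_{t=p} K(z,t) - ∂/∂t̄_j|_{t=p} log K(t,t))`,
where `g^{j̄ α}` is the `(j, α)` entry of the inverse of `[g_{α j̄}]`. -/
def bergmanRep {n : ℕ} (Ω : Set (Fin n → ℂ)) (p z : Fin n → ℂ) : Fin n → ℂ := fun α =>
  ∑ j, (bergmanMetric Ω p)⁻¹ j α *
    ((bergmanKernel Ω z p)⁻¹ * wirtingerBar j (fun t => bergmanKernel Ω z t) p
      - wirtingerBar j (logBergmanDiag Ω) p)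

/-- The Euclidean ball of center `a` and radius `r` in `ℂⁿ` (`Fin n → ℂ` itself carries the
sup norm, which has the same topology, bounded sets and differentiable maps). -/
def euclideanBall {n : ℕ} (a : Fin n → ℂ) (r : ℝ) : Set (Fin n → ℂ) :=
  {z | ∑ i, ‖z i - a i‖ ^ 2 < r ^ 2}

/-- The ball `{w : ∑ w_α g_{α β̄}(p) conj(w_β) < n + 1}` in the inner product that the Bergman
metric induces at `p`. -/
def bergmanBall {n : ℕ} (Ω : Set (Fin n → ℂ)) (p : Fin n → ℂ) : Set (Fin n → ℂ) :=
  {w | (∑ α, ∑ β, w α * bergmanMetric Ω p α β * starRingEnd ℂ (w β)).re < (n : ℝ) + 1}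

/-- `F` maps `A` biholomorphically onto `B`, with inverse `G`. -/
structure IsBiholomorphism {n : ℕ} (F G : (Fin n → ℂ) → (Fin n → ℂ)) (A B : Set (Fin n → ℂ)) :
    Prop where
  mapsTo : Set.MapsTo F A B
  mapsTo_inv : Set.MapsTo G B A
  invOn : Set.InvOn G F A B
  holomorphic : DifferentiableOn ℂ F A
  holomorphic_inv : DifferentiableOn ℂ G B

/-- Condition (B) for `Ω` and the (nonempty) open set `U ⊆ Ω`: there is a finite constant `C > 0`
with `|∂K(z, p)/∂z_j| ≤ C |K(z, p)|` for all `j`, all `z ∈ Ω` and all `p ∈ U`. -/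
def ConditionB {n : ℕ} (Ω U : Set (Fin n → ℂ)) : Prop :=
  IsOpen U ∧ U.Nonempty ∧ U ⊆ Ω ∧ ∃ C : ℝ, 0 < C ∧
    ∀ j : Fin n, ∀ z ∈ Ω, ∀ p ∈ U,
      ‖wirtinger j (fun ζ => bergmanKernel Ω ζ p) z‖ ≤ C * ‖bergmanKernel Ω z p‖

end

/-! Composing the given biholomorphism with a scaling and a ball automorphism gives `F : Ω → B` onto
the unit ball with `F p = 0` and inverse `G`. With `J` the complex Jacobian of `F` and `V` the
volume of `B`, the kernel is `K(z,t) = V⁻¹ J(z) conj(J(t)) (1 - ⟨F z, F t⟩)^(-(n+1))`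
(`IsBiholomorphism.bergmanKernel_eq`). If `F t = 0`, this is the mean value property pulled back by
`F`; the general case uses the automorphism moving `F t` to `0`.

Since `F p = 0`, differentiating this formula makes the metric at `p` equal to `(n+1)` times the
Gram matrix of `F'(p)`, and the representative coordinate becomes `F'(p)⁻¹ ∘ F = G'(0) ∘ F`
(`IsBiholomorphism.bergmanRep_eq`). Its image is `G'(0) B`, which is the ball of the metric.

For the boundary, the logarithmic derivative of `K(·,t)` is that of `J` plus a term linear in `∂F`
that vanishes at `t = p`. Comparing `t = p` with nearby points of `U` therefore bounds every `∂_j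
F_k`. The lower bound on `|K(·,p)|` bounds `|J|` below, so Cramer's rule bounds `G'`. As the ball is
convex, `G` is Lipschitz (`IsBiholomorphism.exists_lipschitzOnWith_inv`) and extends continuously.
The extension maps the sphere onto `∂Ω`, and local connectedness passes to this quotient. -/

open MeasureTheory Metric Set Filter Topology

/-! ### Cauchy estimates, holomorphy of derivatives, and quotients -/

/-- Cauchy's estimate for the Fréchet derivative of a holomorphic map. -/
theorem norm_fderiv_le_of_norm_le {E : Type*} [NormedAddCommGroup E] [NormedSpace ℂ E]
    {f : E → ℂ} {z : E} {r M : ℝ} (hr : 0 < r)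
    (hf : DifferentiableOn ℂ f (ball z (2 * r)))
    (hM : ∀ w ∈ closedBall z r, ‖f w‖ ≤ M) : ‖fderiv ℂ f z‖ ≤ M / r := by
  have hM0 : 0 ≤ M := (norm_nonneg _).trans (hM z (mem_closedBall_self hr.le))
  refine ContinuousLinearMap.opNorm_le_bound _ (by positivity) fun w => ?_
  rcases eq_or_ne w 0 with rfl | hw
  · simp
  have hw' : 0 < ‖w‖ := norm_pos_iff.2 hw
  have hdz : HasFDerivAt f (fderiv ℂ f z) z :=
    (hf.differentiableAt (isOpen_ball.mem_nhds (mem_ball_self (by positivity)))).hasFDerivAt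
  -- On the complex line through `z` in direction `w`, the disc of radius `r / ‖w‖` stays in the
  -- closed ball, so the one-variable Cauchy estimate gives `M ‖w‖ / r`.
  have hmem : ∀ t : ℂ, ‖t‖ ≤ r / ‖w‖ → z + t • w ∈ closedBall z r := fun t ht => by
    rw [mem_closedBall, dist_eq_norm, add_sub_cancel_left, norm_smul]
    exact (le_div_iff₀ hw').1 ht
  have hd : HasDerivAt (fun t : ℂ => f (z + t • w)) (fderiv ℂ f z w) 0 := by
    have h1 : HasDerivAt (fun t : ℂ => z + t • w) w 0 := by
      simpa using ((hasDerivAt_id (0 : ℂ)).smul_const w).const_add z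
    have h2 : HasFDerivAt f (fderiv ℂ f z) (z + (0 : ℂ) • w) := by simpa using hdz
    exact h2.comp_hasDerivAt (0 : ℂ) h1
  have hcl : DiffContOnCl ℂ (fun t : ℂ => f (z + t • w)) (ball 0 (r / ‖w‖)) := by
    apply DifferentiableOn.diffContOnCl
    rw [closure_ball _ (by positivity)]
    refine hf.comp (by fun_prop) fun t ht => ?_
    have := hmem t (by simpa using ht)
    exact closedBall_subset_ball (by linarith) this
  have := Complex.norm_deriv_le_of_forall_mem_sphere_norm_le (by positivity) hcl
    (C := M) fun t ht => hM _ (hmem t (by simpa using (mem_sphere_zero_iff_norm.1 ht).le))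
  rw [hd.deriv] at this
  calc _ ≤ _ := this
    _ = _ := by field_simp

/-- Directional derivatives of holomorphic functions of several variables are holomorphic. -/
theorem differentiableOn_fderiv_apply {n : ℕ} {Ω : Set (Fin n → ℂ)} (hΩ : IsOpen Ω)
    {f : (Fin n → ℂ) → ℂ} (hf : DifferentiableOn ℂ f Ω) (v : Fin n → ℂ) :
    DifferentiableOn ℂ (fun z => fderiv ℂ f z v) Ω := by
  intro z₀ hz₀
  obtain ⟨R, hR, hRΩ⟩ := Metric.isOpen_iff.1 hΩ z₀ hz₀
  -- The points `z + t • v` used below lie in the ball of radius `2r`; Cauchy estimates there reach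
  -- up to `4r`, still well inside `Ω`.
  set r := R / 8 with hr
  have hrpos : 0 < r := by positivity
  have hcb : closedBall z₀ (4 * r) ⊆ Ω := (closedBall_subset_ball (by linarith)).trans hRΩ
  obtain ⟨M, hM⟩ := (isCompact_closedBall z₀ (4 * r)).exists_bound_of_continuousOn
    (hf.continuousOn.mono hcb)
  have hbound : ∀ z ∈ ball z₀ (2 * r), ‖fderiv ℂ f z‖ ≤ M / r := fun z hz => by
    have hz' := mem_ball.1 hz
    refine norm_fderiv_le_of_norm_le hrpos (hf.mono ?_) fun w hw => hM w ?_
    · exact (ball_subset_closedBall.trans (closedBall_subset_closedBall' (by linarith))).trans hcb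
    · exact closedBall_subset_closedBall' (by linarith) hw
  set δ := r / (‖v‖ + 1) with hδ
  have hδpos : 0 < δ := by positivity
  have hδv : δ * ‖v‖ < r := by
    rw [hδ, div_mul_eq_mul_div, div_lt_iff₀ (by positivity)]
    nlinarith [norm_nonneg v]
  have hmem : ∀ z ∈ ball z₀ r, ∀ t : ℂ, ‖t‖ ≤ δ → z + t • v ∈ ball z₀ (2 * r) :=
    fun z hz t ht => by
    have h1 : ‖t • v‖ < r := by
      rw [norm_smul]
      exact (mul_le_mul_of_nonneg_right ht (norm_nonneg v)).trans_lt hδv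
    rw [mem_ball, dist_eq_norm] at hz ⊢
    calc ‖z + t • v - z₀‖ = ‖(z - z₀) + t • v‖ := by congr 1; abel
      _ ≤ ‖z - z₀‖ + ‖t • v‖ := norm_add_le _ _
      _ < 2 * r := by linarith
  have h2Ω : ball z₀ (2 * r) ⊆ Ω :=
    (ball_subset_closedBall.trans (closedBall_subset_closedBall (by linarith))).trans hcb
  have hdiff : ∀ z ∈ ball z₀ (2 * r), HasFDerivAt f (fderiv ℂ f z) z := fun z hz =>
    (hf.differentiableAt (hΩ.mem_nhds (h2Ω hz))).hasFDerivAt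
  -- The weight `dζ / ζ²` of Cauchy's formula for a first derivative. The resulting integral
  -- contains only values of `f`, so it can be differentiated in `z` under the integral sign.
  set c : ℝ → ℂ := fun θ => deriv (circleMap 0 δ) θ * (circleMap 0 δ θ ^ 2)⁻¹ with hc
  have hcm : ∀ θ, ‖circleMap 0 δ θ‖ = δ := fun θ => by simp [abs_of_pos hδpos]
  have hccont : Continuous c := by
    have h0 : ∀ θ, circleMap 0 δ θ ^ 2 ≠ 0 := fun θ => by
      simp [hδpos.ne']
    simp only [hc, deriv_circleMap]
    have := (continuous_circleMap 0 δ)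
    fun_prop (disch := assumption)
  have hrep : ∀ z ∈ ball z₀ r, fderiv ℂ f z v =
      (2 * Real.pi * Complex.I : ℂ)⁻¹ *
        ∫ θ in (0 : ℝ)..2 * Real.pi, c θ * f (z + circleMap 0 δ θ • v) := fun z hz => by
    have hzz : z ∈ ball z₀ (2 * r) := ball_subset_ball (by linarith) hz
    have hd : HasDerivAt (fun t : ℂ => f (z + t • v)) (fderiv ℂ f z v) 0 := by
      have h1 : HasDerivAt (fun t : ℂ => z + t • v) v 0 := by
        simpa using ((hasDerivAt_id (0 : ℂ)).smul_const v).const_add z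
      have h2 : HasFDerivAt f (fderiv ℂ f z) (z + (0 : ℂ) • v) := by simpa using hdiff z hzz
      exact h2.comp_hasDerivAt (0 : ℂ) h1
    have hcl : DiffContOnCl ℂ (fun t : ℂ => f (z + t • v)) (ball 0 δ) := by
      apply DifferentiableOn.diffContOnCl
      rw [closure_ball _ hδpos.ne']
      exact (hf.mono h2Ω).comp (by fun_prop) fun t ht => hmem z hz t (by simpa using ht)
    have := hcl.deriv_eq_smul_circleIntegral hδpos
    rw [hd.deriv, circleIntegral] at this
    rw [eq_inv_mul_iff_mul_eq₀ Complex.two_pi_I_ne_zero, ← smul_eq_mul, ← this]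
    refine intervalIntegral.integral_congr fun θ _ => ?_
    simp [hc, mul_assoc]
  have key : DifferentiableAt ℂ (fun z => ∫ θ in (0 : ℝ)..2 * Real.pi,
      c θ * f (z + circleMap 0 δ θ • v)) z₀ := by
    simp only [intervalIntegral.integral_of_le Real.two_pi_pos.le]
    have hcont : ∀ z ∈ ball z₀ r, Continuous fun θ => c θ * f (z + circleMap 0 δ θ • v) :=
      fun z hz => hccont.mul <| (hf.continuousOn.mono h2Ω).comp_continuous
        (continuous_const.add ((continuous_circleMap 0 δ).smul continuous_const))
        fun θ => hmem z hz _ (hcm θ).le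
    refine (hasFDerivAt_integral_of_dominated_of_fderiv_le (𝕜 := ℂ)
      (F' := fun z θ => c θ • fderiv ℂ f (z + circleMap 0 δ θ • v))
      (bound := fun θ => ‖c θ‖ * (M / r)) (ball_mem_nhds z₀ hrpos) ?_ ?_ ?_ ?_ ?_ ?_).differentiableAt
    · filter_upwards [ball_mem_nhds z₀ hrpos] with z hz
      exact (hcont z hz).aestronglyMeasurable
    · exact ((hcont z₀ (mem_ball_self hrpos)).integrableOn_Icc.mono_set Ioc_subset_Icc_self)
    · refine AEStronglyMeasurable.smul hccont.aestronglyMeasurable ?_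
      -- Continuity of the derivative is not yet known; its measurability is enough here.
      refine Measurable.aestronglyMeasurable ?_
      exact (measurable_fderiv ℂ f).comp
        (continuous_const.add ((continuous_circleMap 0 δ).smul continuous_const)).measurable
    · refine Eventually.of_forall fun θ z hz => ?_
      rw [norm_smul]
      exact mul_le_mul_of_nonneg_left (hbound _ (hmem z hz _ (hcm θ).le)) (norm_nonneg _)
    · exact ((hccont.norm.mul continuous_const).integrableOn_Icc.mono_set Ioc_subset_Icc_self)
    · refine Eventually.of_forall fun θ z hz => ?_
      have h1 := hdiff _ (hmem z hz _ (hcm θ).le)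
      have h2 := h1.comp z ((hasFDerivAt_id z).add_const (circleMap 0 δ θ • v))
      simpa using h2.const_mul (c θ)
  refine ((key.const_mul (2 * Real.pi * Complex.I : ℂ)⁻¹).congr_of_eventuallyEq ?_)
    |>.differentiableWithinAt
  filter_upwards [ball_mem_nhds z₀ hrpos] with z hz using hrep z hz

/-- A quotient of a locally connected space is locally connected. -/
theorem Topology.IsQuotientMap.locallyConnectedSpace {X Y : Type*} [TopologicalSpace X]
    [TopologicalSpace Y] [LocallyConnectedSpace X] {f : X → Y} (hf : IsQuotientMap f) :
    LocallyConnectedSpace Y := by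
  rw [locallyConnectedSpace_iff_connectedComponentIn_open]
  intro V hV y hy
  rw [← hf.isOpen_preimage, isOpen_iff_mem_nhds]
  intro x hx
  have hVx : f x ∈ V := connectedComponentIn_subset _ _ hx
  -- The component of `x` in the preimage of `V` is an open neighbourhood with connected image in
  -- `V`, so this image stays in the component of `f x`.
  have hopen : IsOpen (connectedComponentIn (f ⁻¹' V) x) :=
    (hV.preimage hf.continuous).connectedComponentIn
  filter_upwards [hopen.mem_nhds (mem_connectedComponentIn (F := f ⁻¹' V) hVx)] with x' hx'
  have hpre := isPreconnected_connectedComponentIn (F := f ⁻¹' V) (x := x)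
    |>.image f hf.continuous.continuousOn
  have hsub := hpre.subset_connectedComponentIn (F := V)
    (mem_image_of_mem f (mem_connectedComponentIn (F := f ⁻¹' V) hVx))
    (image_subset_iff.2 (connectedComponentIn_subset _ _))
  rw [mem_preimage, connectedComponentIn_eq hx]
  exact hsub (mem_image_of_mem f hx')

/-! ### Automorphisms of the unit ball -/

section UnitBall

variable {n : ℕ}

theorem dotProduct_star_self (z : Fin n → ℂ) :
    z ⬝ᵥ star z = ((∑ i, ‖z i‖ ^ 2 : ℝ) : ℂ) := by
  simp [dotProduct, Complex.mul_conj, Complex.normSq_eq_norm_sq]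

theorem dotProduct_star_comm (z w : Fin n → ℂ) :
    star (z ⬝ᵥ star w) = w ⬝ᵥ star z := by
  simp [dotProduct, mul_comm]

theorem mem_unitBall {z : Fin n → ℂ} : z ∈ euclideanBall 0 1 ↔ ∑ i, ‖z i‖ ^ 2 < 1 := by
  simp [euclideanBall]

theorem norm_dotProduct_star_sq_le (z w : Fin n → ℂ) :
    ‖z ⬝ᵥ star w‖ ^ 2 ≤ (∑ i, ‖z i‖ ^ 2) * ∑ i, ‖w i‖ ^ 2 := by
  have h1 : ‖z ⬝ᵥ star w‖ ≤ ∑ i, ‖z i‖ * ‖w i‖ := by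
    refine (norm_sum_le _ _).trans_eq ?_
    simp
  exact (pow_le_pow_left₀ (norm_nonneg _) h1 2).trans (Finset.sum_mul_sq_le_sq_mul_sq _ _ _)

theorem norm_dotProduct_star_lt_one {z w : Fin n → ℂ} (hz : z ∈ euclideanBall 0 1)
    (hw : w ∈ euclideanBall 0 1) : ‖z ⬝ᵥ star w‖ < 1 := by
  rw [mem_unitBall] at hz hw
  have h := norm_dotProduct_star_sq_le z w
  have h0 : 0 ≤ ∑ i, ‖z i‖ ^ 2 := by positivity
  have h1 : 0 ≤ ∑ i, ‖w i‖ ^ 2 := by positivity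
  rw [← sq_lt_one_iff₀ (norm_nonneg _)]
  nlinarith

theorem one_sub_dotProduct_star_ne_zero {z w : Fin n → ℂ} (hz : z ∈ euclideanBall 0 1)
    (hw : w ∈ euclideanBall 0 1) : 1 - z ⬝ᵥ star w ≠ 0 := fun h => by
  have := norm_dotProduct_star_lt_one hz hw
  rw [← sub_eq_zero.1 h] at this
  simp at this

theorem isOpen_euclideanBall (a : Fin n → ℂ) (r : ℝ) : IsOpen (euclideanBall a r) :=
  isOpen_lt (by fun_prop) continuous_const

/-- The involutive automorphism of the unit ball that exchanges `0` and `a`. -/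
noncomputable def ballInvolution (a z : Fin n → ℂ) : Fin n → ℂ :=
  (1 - z ⬝ᵥ star a)⁻¹ • (a - ((√(1 - ∑ i, ‖a i‖ ^ 2) : ℝ) : ℂ) • z
    - ((z ⬝ᵥ star a) / (1 + (√(1 - ∑ i, ‖a i‖ ^ 2) : ℝ))) • a)

/-- Trades the square root for a number `s` with `⟨a, a⟩ = 1 - s²`, so that the identities for the
involution become rational identities in `s` and a few inner products. -/
theorem exists_sqrt_one_sub {a : Fin n → ℂ} (ha : a ∈ euclideanBall 0 1) :
    ∃ s : ℝ, 0 < s ∧ s = √(1 - ∑ i, ‖a i‖ ^ 2) ∧ a ⬝ᵥ star a = 1 - (s : ℂ) ^ 2 := by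
  rw [mem_unitBall] at ha
  refine ⟨_, Real.sqrt_pos.2 (by linarith), rfl, ?_⟩
  rw [dotProduct_star_self, ← Complex.ofReal_pow, Real.sq_sqrt (by linarith)]
  simp

theorem ballInvolution_self {a : Fin n → ℂ} (ha : a ∈ euclideanBall 0 1) :
    ballInvolution a a = 0 := by
  obtain ⟨s, hs, hs', h⟩ := exists_sqrt_one_sub ha
  have h1 : (1 + s : ℂ) ≠ 0 := by exact_mod_cast (by positivity : (1 + s : ℝ) ≠ 0)
  rw [ballInvolution, ← hs', h]
  have : a - (s : ℂ) • a - ((1 - (s : ℂ) ^ 2) / (1 + s)) • a = 0 := by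
    rw [show (1 - (s : ℂ) ^ 2) / (1 + s) = 1 - s by field_simp; ring]
    module
  rw [this, smul_zero]

theorem one_sub_ballInvolution_dotProduct {a z : Fin n → ℂ} (ha : a ∈ euclideanBall 0 1)
    (hz : z ∈ euclideanBall 0 1) :
    1 - ballInvolution a z ⬝ᵥ star a = (1 - a ⬝ᵥ star a) / (1 - z ⬝ᵥ star a) := by
  obtain ⟨s, hs, hs', h⟩ := exists_sqrt_one_sub ha
  have h1 : (1 + s : ℂ) ≠ 0 := by exact_mod_cast (by positivity : (1 + s : ℝ) ≠ 0)
  have hd := one_sub_dotProduct_star_ne_zero hz ha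
  rw [ballInvolution, ← hs']
  simp only [smul_dotProduct, sub_dotProduct, h, smul_eq_mul]
  generalize z ⬝ᵥ star a = c at *
  field_simp
  ring

theorem ballInvolution_mem {a z : Fin n → ℂ} (ha : a ∈ euclideanBall 0 1)
    (hz : z ∈ euclideanBall 0 1) : ballInvolution a z ∈ euclideanBall 0 1 := by
  obtain ⟨s, hs, hs', h⟩ := exists_sqrt_one_sub ha
  have h1 : (1 + s : ℂ) ≠ 0 := by exact_mod_cast (by positivity : (1 + s : ℝ) ≠ 0)
  have hd := one_sub_dotProduct_star_ne_zero hz ha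
  have hd' : 1 - a ⬝ᵥ star z ≠ 0 := one_sub_dotProduct_star_ne_zero ha hz
  -- The identity `1 - |φ_a(z)|² = s² (1 - |z|²) / |1 - ⟨z, a⟩|²`; positivity of its right side is
  -- the claim.
  have key : 1 - ballInvolution a z ⬝ᵥ star (ballInvolution a z) =
      (s : ℂ) ^ 2 * (1 - z ⬝ᵥ star z) / ((1 - z ⬝ᵥ star a) * star (1 - z ⬝ᵥ star a)) := by
    have e : star (1 - z ⬝ᵥ star a) = 1 - a ⬝ᵥ star z := by
      rw [star_sub, star_one, dotProduct_star_comm]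
    have e' : star (s : ℂ) = s := Complex.conj_ofReal s
    rw [ballInvolution, ← hs', e]
    simp only [smul_dotProduct, sub_dotProduct, dotProduct_smul, dotProduct_sub, star_smul,
      star_sub, star_inv₀, star_div₀, star_one, star_add, h, smul_eq_mul, dotProduct_star_comm, e']
    generalize z ⬝ᵥ star a = c at *
    generalize a ⬝ᵥ star z = c' at *
    generalize z ⬝ᵥ star z = q at *
    field_simp
    ring
  rw [mem_unitBall] at hz ⊢
  rw [Complex.star_def, Complex.mul_conj, Complex.normSq_eq_norm_sq, dotProduct_star_self,
    dotProduct_star_self] at key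
  have key' : 1 - ∑ i, ‖ballInvolution a z i‖ ^ 2 =
      s ^ 2 * (1 - ∑ i, ‖z i‖ ^ 2) / ‖1 - z ⬝ᵥ star a‖ ^ 2 := by exact_mod_cast key
  have hpos : 0 < s ^ 2 * (1 - ∑ i, ‖z i‖ ^ 2) / ‖1 - z ⬝ᵥ star a‖ ^ 2 := by
    have := norm_pos_iff.2 hd
    have : 0 < 1 - ∑ i, ‖z i‖ ^ 2 := by linarith
    positivity
  linarith

theorem ballInvolution_ballInvolution {a z : Fin n → ℂ} (ha : a ∈ euclideanBall 0 1)
    (hz : z ∈ euclideanBall 0 1) : ballInvolution a (ballInvolution a z) = z := by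
  have h0 := one_sub_ballInvolution_dotProduct ha hz
  obtain ⟨s, hs, hs', h⟩ := exists_sqrt_one_sub ha
  have h1 : (1 + s : ℂ) ≠ 0 := by exact_mod_cast (by positivity : (1 + s : ℝ) ≠ 0)
  have hs0 : (s : ℂ) ≠ 0 := by exact_mod_cast hs.ne'
  have hd := one_sub_dotProduct_star_ne_zero hz ha
  have h2 : ballInvolution a z ⬝ᵥ star a = 1 - (s : ℂ) ^ 2 / (1 - z ⬝ᵥ star a) := by
    rw [h] at h0; linear_combination -h0
  rw [ballInvolution, h2, ballInvolution, ← hs']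
  generalize z ⬝ᵥ star a = c at *
  ext i
  simp only [Pi.smul_apply, Pi.sub_apply, smul_eq_mul]
  field_simp
  ring

/-- The derivative of `ballInvolution a`, as a multiple of a transvection. -/
theorem hasFDerivAt_ballInvolution {a z : Fin n → ℂ} (ha : a ∈ euclideanBall 0 1)
    (hz : z ∈ euclideanBall 0 1) :
    ∃ L : (Fin n → ℂ) →L[ℂ] (Fin n → ℂ), HasFDerivAt (ballInvolution a) L z ∧
      L.det = (-1) ^ n * ((√(1 - ∑ i, ‖a i‖ ^ 2) : ℝ) / (1 - z ⬝ᵥ star a)) ^ (n + 1) := by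
  have h0 := one_sub_ballInvolution_dotProduct ha hz
  obtain ⟨s, hs, hs', h⟩ := exists_sqrt_one_sub ha
  have h1 : (1 + s : ℂ) ≠ 0 := by exact_mod_cast (by positivity : (1 + s : ℝ) ≠ 0)
  have hs0 : (s : ℂ) ≠ 0 := by exact_mod_cast hs.ne'
  have hd := one_sub_dotProduct_star_ne_zero hz ha
  let φ : (Fin n → ℂ) →L[ℂ] ℂ :=
    LinearMap.toContinuousLinearMap
      { toFun := fun x => x ⬝ᵥ star a
        map_add' := fun x y => add_dotProduct _ _ _
        map_smul' := fun c x => smul_dotProduct _ _ _ }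
  have hφ : ∀ x, φ x = x ⬝ᵥ star a := fun x => rfl
  -- By the product rule, the derivative is `-(s / (1 - ⟨z, a⟩))` times `x ↦ x + φ(x) v` for this
  -- `v`. The transvection has determinant `1 + φ(v) = s / (1 - ⟨z, a⟩)`, which supplies the extra
  -- factor in the power `n + 1`.
  let v : Fin n → ℂ := ((1 + s : ℂ)⁻¹ * (s : ℂ)⁻¹) • a - (s : ℂ)⁻¹ • ballInvolution a z
  let L : (Fin n → ℂ) →L[ℂ] (Fin n → ℂ) :=
    (-(s / (1 - z ⬝ᵥ star a)) : ℂ) • LinearMap.toContinuousLinearMap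
      (LinearMap.transvection (φ : (Fin n → ℂ) →ₗ[ℂ] ℂ) v)
  refine ⟨L, ?_, ?_⟩
  · have e1 : HasFDerivAt (fun x : Fin n → ℂ => (1 - x ⬝ᵥ star a)⁻¹)
        (-((1 - z ⬝ᵥ star a) ^ 2)⁻¹ • (-φ)) z := by
      have := (φ.hasFDerivAt (x := z)).const_sub (1 : ℂ)
      exact (hasDerivAt_inv hd).comp_hasFDerivAt z this
    have e2 : HasFDerivAt (fun x : Fin n → ℂ => a - (s : ℂ) • x - ((x ⬝ᵥ star a) / (1 + s)) • a)
        (0 - (s : ℂ) • ContinuousLinearMap.id ℂ _ - ((1 + s : ℂ)⁻¹ • φ).smulRight a) z := by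
      refine HasFDerivAt.sub (HasFDerivAt.sub (hasFDerivAt_const _ _)
        ((hasFDerivAt_id z).const_smul (s : ℂ))) ?_
      have := ((φ.hasFDerivAt (x := z)).const_smul (1 + s : ℂ)⁻¹).smul_const a
      refine this.congr_of_eventuallyEq (Eventually.of_forall fun x => ?_)
      simp [hφ, div_eq_inv_mul]
    have e3 := e1.smul e2
    have e4 : ballInvolution a = fun x : Fin n → ℂ => (1 - x ⬝ᵥ star a)⁻¹ •
        (a - (s : ℂ) • x - ((x ⬝ᵥ star a) / (1 + s)) • a) := by
      ext1 x; rw [ballInvolution, hs']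
    rw [e4]
    refine e3.congr_fderiv ?_
    ext1 x
    have e5 : ballInvolution a z = (1 - z ⬝ᵥ star a)⁻¹ •
        (a - (s : ℂ) • z - ((z ⬝ᵥ star a) / (1 + s)) • a) := by rw [e4]
    simp only [L, v, e5, _root_.add_apply, _root_.smul_apply,
      ContinuousLinearMap.smulRight_apply, _root_.sub_apply,
      _root_.zero_apply, _root_.neg_apply,
      ContinuousLinearMap.id_apply, LinearMap.coe_toContinuousLinearMap',
      LinearMap.transvection.apply, ContinuousLinearMap.coe_coe, smul_eq_mul]
    simp only [hφ]
    generalize z ⬝ᵥ star a = c at *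
    generalize x ⬝ᵥ star a = c' at *
    ext i
    simp only [Pi.smul_apply, Pi.sub_apply, Pi.add_apply, Pi.zero_apply, smul_eq_mul]
    field_simp
    ring
  · have e1 : φ v = ((1 + s : ℂ)⁻¹ * (s : ℂ)⁻¹) * (1 - s ^ 2) -
        (s : ℂ)⁻¹ * (1 - s ^ 2 / (1 - z ⬝ᵥ star a)) := by
      have h2 : ballInvolution a z ⬝ᵥ star a = 1 - (s : ℂ) ^ 2 / (1 - z ⬝ᵥ star a) := by
        rw [h] at h0; linear_combination -h0
      simp only [hφ, v, sub_dotProduct, smul_dotProduct, h, h2, smul_eq_mul]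
    have e2 : L.det = (-(s / (1 - z ⬝ᵥ star a)) : ℂ) ^ n * (1 + φ v) := by
      rw [ContinuousLinearMap.det]
      simp only [L, ContinuousLinearMap.toLinearMap_smul, LinearMap.coe_toContinuousLinearMap, LinearMap.det_smul,
        LinearMap.transvection.det]
      simp
    rw [e2, e1, ← hs', neg_pow, pow_succ, mul_assoc]
    congr 2
    field_simp
    ring

end UnitBall

/-! ### Complex Jacobians and the transformation of the Bergman kernel -/

section Kernel

variable {n : ℕ}

/-- The real determinant of a complex linear map is the norm from `ℂ` to `ℝ` of its complex
determinant. -/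
theorem abs_det_restrictScalars (L : (Fin n → ℂ) →L[ℂ] (Fin n → ℂ)) :
    |(L.restrictScalars ℝ).det| = ‖L.det‖ ^ 2 := by
  have : (L.restrictScalars ℝ).det = Complex.normSq L.det := by
    rw [ContinuousLinearMap.det, ContinuousLinearMap.det, ← Algebra.norm_complex_apply,
      ← LinearMap.det_restrictScalars]
    rfl
  rw [this, abs_of_nonneg (Complex.normSq_nonneg _), Complex.normSq_eq_norm_sq]

/-- The complex Jacobian determinant. -/
noncomputable def complexJacobian (F : (Fin n → ℂ) → (Fin n → ℂ)) (z : Fin n → ℂ) : ℂ :=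
  (fderiv ℂ F z).det

theorem complexJacobian_comp {F H : (Fin n → ℂ) → (Fin n → ℂ)} {z : Fin n → ℂ}
    (hF : DifferentiableAt ℂ F z) (hH : DifferentiableAt ℂ H (F z)) :
    complexJacobian (H ∘ F) z = complexJacobian H (F z) * complexJacobian F z := by
  rw [complexJacobian, fderiv_comp z hH hF]
  exact LinearMap.det_comp _ _

theorem complexJacobian_eq_det (F : (Fin n → ℂ) → (Fin n → ℂ)) (z : Fin n → ℂ) :
    complexJacobian F z = (Matrix.of fun i j => fderiv ℂ F z (Pi.single j 1) i).det := by
  rw [complexJacobian, ContinuousLinearMap.det, ← LinearMap.det_toMatrix']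
  congr 1

theorem differentiableOn_fderiv_apply_pi {Ω : Set (Fin n → ℂ)} (hΩ : IsOpen Ω)
    {F : (Fin n → ℂ) → (Fin n → ℂ)} (hF : DifferentiableOn ℂ F Ω) (v : Fin n → ℂ) (i : Fin n) :
    DifferentiableOn ℂ (fun z => fderiv ℂ F z v i) Ω := by
  have hFi : DifferentiableOn ℂ (fun z => F z i) Ω := differentiableOn_pi.1 hF i
  refine (differentiableOn_fderiv_apply hΩ hFi v).congr fun z hz => ?_
  rw [fderiv_apply (hF.differentiableAt (hΩ.mem_nhds hz))]
  rfl

theorem differentiableOn_complexJacobian {Ω : Set (Fin n → ℂ)} (hΩ : IsOpen Ω)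
    {F : (Fin n → ℂ) → (Fin n → ℂ)} (hF : DifferentiableOn ℂ F Ω) :
    DifferentiableOn ℂ (complexJacobian F) Ω := by
  simp only [funext (complexJacobian_eq_det F), Matrix.det_apply, Matrix.of_apply]
  refine DifferentiableOn.fun_sum fun σ _ => DifferentiableOn.const_smul ?_ _
  intro z hz
  exact (HasFDerivWithinAt.finsetProd fun i _ => (differentiableOn_fderiv_apply_pi hΩ hF
    (Pi.single i 1) (σ i) z hz).hasFDerivWithinAt).differentiableWithinAt

theorem IsBiholomorphism.image_eq {F G : (Fin n → ℂ) → (Fin n → ℂ)} {A B : Set (Fin n → ℂ)}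
    (h : IsBiholomorphism F G A B) : F '' A = B :=
  h.mapsTo.image_subset.antisymm fun w hw => ⟨G w, h.mapsTo_inv hw, h.invOn.2 hw⟩

theorem IsBiholomorphism.symm {F G : (Fin n → ℂ) → (Fin n → ℂ)} {A B : Set (Fin n → ℂ)}
    (h : IsBiholomorphism F G A B) : IsBiholomorphism G F B A :=
  ⟨h.mapsTo_inv, h.mapsTo, h.invOn.symm, h.holomorphic_inv, h.holomorphic⟩

theorem IsBiholomorphism.trans {F G F' G' : (Fin n → ℂ) → (Fin n → ℂ)}
    {A B C : Set (Fin n → ℂ)} (h : IsBiholomorphism F G A B) (h' : IsBiholomorphism F' G' B C) :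
    IsBiholomorphism (F' ∘ F) (G ∘ G') A C where
  mapsTo := h'.mapsTo.comp h.mapsTo
  mapsTo_inv := h.mapsTo_inv.comp h'.mapsTo_inv
  invOn := h.invOn.comp h'.invOn h.mapsTo h'.mapsTo_inv
  holomorphic := h'.holomorphic.comp h.holomorphic h.mapsTo
  holomorphic_inv := h.holomorphic_inv.comp h'.holomorphic_inv h'.mapsTo_inv

theorem IsBiholomorphism.fderiv_comp_fderiv {F G : (Fin n → ℂ) → (Fin n → ℂ)}
    {A B : Set (Fin n → ℂ)} (h : IsBiholomorphism F G A B) (hA : IsOpen A) (hB : IsOpen B)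
    {z : Fin n → ℂ} (hz : z ∈ A) :
    (fderiv ℂ G (F z)).comp (fderiv ℂ F z) = ContinuousLinearMap.id ℂ _ := by
  have h1 : DifferentiableAt ℂ F z := h.holomorphic.differentiableAt (hA.mem_nhds hz)
  have h2 : DifferentiableAt ℂ G (F z) :=
    h.holomorphic_inv.differentiableAt (hB.mem_nhds (h.mapsTo hz))
  rw [← fderiv_comp z h2 h1]
  have : G ∘ F =ᶠ[𝓝 z] id := by
    filter_upwards [hA.mem_nhds hz] with w hw using h.invOn.1 hw
  rw [this.fderiv_eq, fderiv_id]

theorem IsBiholomorphism.complexJacobian_mul {F G : (Fin n → ℂ) → (Fin n → ℂ)}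
    {A B : Set (Fin n → ℂ)} (h : IsBiholomorphism F G A B) (hA : IsOpen A) (hB : IsOpen B)
    {z : Fin n → ℂ} (hz : z ∈ A) : complexJacobian G (F z) * complexJacobian F z = 1 := by
  have := congrArg ContinuousLinearMap.det (h.fderiv_comp_fderiv hA hB hz)
  rw [show ContinuousLinearMap.det ((fderiv ℂ G (F z)).comp (fderiv ℂ F z)) =
    complexJacobian G (F z) * complexJacobian F z from LinearMap.det_comp _ _] at this
  rw [this]
  exact LinearMap.det_id

theorem IsBiholomorphism.complexJacobian_ne_zero {F G : (Fin n → ℂ) → (Fin n → ℂ)}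
    {A B : Set (Fin n → ℂ)} (h : IsBiholomorphism F G A B) (hA : IsOpen A) (hB : IsOpen B)
    {z : Fin n → ℂ} (hz : z ∈ A) : complexJacobian F z ≠ 0 :=
  right_ne_zero_of_mul_eq_one (h.complexJacobian_mul hA hB hz)

section ChangeOfVariables

variable {F G : (Fin n → ℂ) → (Fin n → ℂ)} {A B : Set (Fin n → ℂ)} {E : Type*}
  [NormedAddCommGroup E] [NormedSpace ℝ E]

theorem IsBiholomorphism.hasFDerivWithinAt (h : IsBiholomorphism F G A B) (hA : IsOpen A) :
    ∀ z ∈ A, HasFDerivWithinAt F ((fderiv ℂ F z).restrictScalars ℝ) A z := fun _ hz =>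
  ((h.holomorphic.differentiableAt (hA.mem_nhds hz)).hasFDerivAt.restrictScalars ℝ)
    |>.hasFDerivWithinAt

theorem IsBiholomorphism.integral_eq (h : IsBiholomorphism F G A B) (hA : IsOpen A)
    (f : (Fin n → ℂ) → E) :
    ∫ w in B, f w = ∫ z in A, ‖complexJacobian F z‖ ^ 2 • f (F z) := by
  rw [← h.image_eq, integral_image_eq_integral_abs_det_fderiv_smul volume hA.measurableSet
    (h.hasFDerivWithinAt hA) h.invOn.1.injOn]
  simp only [abs_det_restrictScalars, complexJacobian]

theorem IsBiholomorphism.integrableOn_iff (h : IsBiholomorphism F G A B) (hA : IsOpen A)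
    (f : (Fin n → ℂ) → E) :
    IntegrableOn f B ↔ IntegrableOn (fun z => ‖complexJacobian F z‖ ^ 2 • f (F z)) A := by
  rw [← h.image_eq, integrableOn_image_iff_integrableOn_abs_det_fderiv_smul volume
    hA.measurableSet (h.hasFDerivWithinAt hA) h.invOn.1.injOn]
  simp only [abs_det_restrictScalars, complexJacobian]

end ChangeOfVariables

theorem smul_mem_unitBall {c : ℂ} (hc : ‖c‖ ≤ 1) {z : Fin n → ℂ} (hz : z ∈ euclideanBall 0 1) :
    c • z ∈ euclideanBall 0 1 := by
  rw [mem_unitBall] at hz ⊢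
  refine lt_of_le_of_lt (Finset.sum_le_sum fun i _ => ?_) hz
  rw [Pi.smul_apply, norm_smul]
  exact pow_le_pow_left₀ (by positivity)
    (mul_le_of_le_one_left (norm_nonneg _) hc) 2

theorem isBiholomorphism_rotation {c : ℂ} (hc : ‖c‖ = 1) :
    IsBiholomorphism (fun z : Fin n → ℂ => c • z) (fun z => c⁻¹ • z)
      (euclideanBall 0 1) (euclideanBall 0 1) := by
  have hc0 : c ≠ 0 := norm_pos_iff.1 (by rw [hc]; exact one_pos)
  refine ⟨fun z hz => smul_mem_unitBall hc.le hz, fun z hz => smul_mem_unitBall (by simp [hc]) hz,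
    ⟨fun z _ => ?_, fun z _ => ?_⟩, by fun_prop, by fun_prop⟩
  · simp [smul_smul, hc0]
  · simp [smul_smul, hc0]

theorem norm_complexJacobian_rotation {c : ℂ} (hc : ‖c‖ = 1) (z : Fin n → ℂ) :
    ‖complexJacobian (fun z : Fin n → ℂ => c • z) z‖ = 1 := by
  have : fderiv ℂ (fun z : Fin n → ℂ => c • z) z = c • ContinuousLinearMap.id ℂ _ :=
    ((hasFDerivAt_id z).const_smul c).fderiv
  rw [complexJacobian, this, ContinuousLinearMap.det, ContinuousLinearMap.toLinearMap_smul,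
    LinearMap.det_smul]
  simp [hc]

theorem isBounded_unitBall : Bornology.IsBounded (euclideanBall (0 : Fin n → ℂ) 1) := by
  refine (Metric.isBounded_closedBall (x := (0 : Fin n → ℂ)) (r := 1)).subset fun z hz => ?_
  rw [mem_unitBall] at hz
  rw [mem_closedBall_zero_iff, pi_norm_le_iff_of_nonneg zero_le_one]
  intro i
  have := Finset.single_le_sum (f := fun i => ‖z i‖ ^ 2) (fun i _ => by positivity)
    (Finset.mem_univ i)
  rw [← sq_le_one_iff₀ (norm_nonneg _)]
  linarith

theorem zero_mem_unitBall : (0 : Fin n → ℂ) ∈ euclideanBall 0 1 := by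
  simp [mem_unitBall]

theorem volume_unitBall_lt_top : volume (euclideanBall (0 : Fin n → ℂ) 1) < ⊤ :=
  isBounded_unitBall.measure_lt_top

theorem volume_real_unitBall_pos : 0 < volume.real (euclideanBall (0 : Fin n → ℂ) 1) :=
  ENNReal.toReal_pos ((isOpen_euclideanBall 0 1).measure_pos volume ⟨0, zero_mem_unitBall⟩).ne'
    volume_unitBall_lt_top.ne

/-- The mean value property of integrable holomorphic functions on the unit ball. -/
theorem integral_unitBall_eq {f : (Fin n → ℂ) → ℂ}
    (hf : DifferentiableOn ℂ f (euclideanBall 0 1)) (hi : IntegrableOn f (euclideanBall 0 1)) :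
    ∫ w in euclideanBall 0 1, f w = volume.real (euclideanBall (0 : Fin n → ℂ) 1) * f 0 := by
  set B : Set (Fin n → ℂ) := euclideanBall 0 1 with hB
  have hBo : IsOpen B := isOpen_euclideanBall 0 1
  have hnorm : ∀ θ : ℝ, ‖circleMap 0 1 θ‖ = 1 := fun θ => by simp
  -- Rotations preserve the ball and its volume. Averaging the integral over all rotations and
  -- swapping the integrals reduces the claim to the mean value property on discs.
  have hrot : ∀ {E : Type} [NormedAddCommGroup E] [NormedSpace ℝ E] (g : (Fin n → ℂ) → E) (θ : ℝ),
      ∫ w in B, g (circleMap 0 1 θ • w) = ∫ w in B, g w := fun g θ => by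
    rw [(isBiholomorphism_rotation (hnorm θ)).integral_eq hBo g]
    simp [norm_complexJacobian_rotation (hnorm θ), hB]
  have hroti : ∀ θ : ℝ, IntegrableOn (fun w => f (circleMap 0 1 θ • w)) B := fun θ => by
    have := ((isBiholomorphism_rotation (hnorm θ)).integrableOn_iff hBo f).1 hi
    simpa [norm_complexJacobian_rotation (hnorm θ)] using this
  have hmean : ∀ w ∈ B, ∫ θ in Ioc 0 (2 * Real.pi), f (circleMap 0 1 θ • w) =
      2 * Real.pi * f 0 := fun w hw => by
    have hcl : DiffContOnCl ℂ (fun c : ℂ => f (c • w)) (ball 0 |1|) := by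
      apply DifferentiableOn.diffContOnCl
      rw [abs_one, closure_ball _ one_ne_zero]
      exact hf.comp (by fun_prop) fun c hc => smul_mem_unitBall (by simpa using hc) hw
    have := hcl.circleAverage
    rw [Real.circleAverage_def, intervalIntegral.integral_of_le Real.two_pi_pos.le,
      inv_smul_eq_iff₀ Real.two_pi_pos.ne'] at this
    simpa using this
  have hprod : Integrable (Function.uncurry fun (θ : ℝ) (w : Fin n → ℂ) =>
      f (circleMap 0 1 θ • w))
      ((volume.restrict (Ioc 0 (2 * Real.pi))).prod (volume.restrict B)) := by
    -- By rotation invariance the `L¹` norm of each slice is independent of `θ`, which gives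
    -- integrability on the product.
    rw [integrable_prod_iff]
    · refine ⟨Eventually.of_forall hroti, ?_⟩
      simp only [Function.uncurry_apply_pair]
      simp only [hrot (fun w => ‖f w‖)]
      exact integrable_const _
    · rw [Measure.prod_restrict]
      refine ContinuousOn.aestronglyMeasurable ?_ (measurableSet_Ioc.prod hBo.measurableSet)
      refine hf.continuousOn.comp (f := fun q : ℝ × (Fin n → ℂ) => circleMap 0 1 q.1 • q.2)
        ?_ fun q hq => smul_mem_unitBall (hnorm _).le hq.2
      exact (((continuous_circleMap 0 1).comp continuous_fst).smul continuous_snd).continuousOn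
  have hswap := integral_integral_swap hprod
  simp only [hrot f] at hswap
  rw [setIntegral_congr_fun (g := fun _ => 2 * Real.pi * f 0) hBo.measurableSet hmean] at hswap
  simp only [integral_const, MeasurableSet.univ, measureReal_restrict_apply, univ_inter,
    Real.volume_real_Ioc_of_le Real.two_pi_pos.le, sub_zero, Complex.real_smul] at hswap
  have hpi : ((2 * Real.pi : ℝ) : ℂ) ≠ 0 := by exact_mod_cast Real.two_pi_pos.ne'
  apply mul_left_cancel₀ hpi
  rw [hswap]
  push_cast
  ring

/-- The difference of two representing functions lies in the Bergman space and is orthogonal to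
itself, so it vanishes almost everywhere and, by continuity, on `Ω`. This makes the choice in
`bergmanKernel` irrelevant on `Ω`. -/
theorem IsReproducingAt.eqOn {Ω : Set (Fin n → ℂ)} (hΩ : IsOpen Ω) {p : Fin n → ℂ}
    {k k' : (Fin n → ℂ) → ℂ} (hk : IsReproducingAt Ω p k) (hk' : IsReproducingAt Ω p k') :
    EqOn k k' Ω := by
  have hd : MemBergmanSpace Ω (k - k') := ⟨hk.1.1.sub hk'.1.1, hk.1.2.sub hk'.1.2⟩
  have hstar : ∀ {u : (Fin n → ℂ) → ℂ}, MemBergmanSpace Ω u →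
      Integrable (fun z => (k - k') z * starRingEnd ℂ (u z)) (volume.restrict Ω) :=
    fun hu => hd.2.integrable_mul hu.2.star
  have h1 : ∫ z in Ω, (k - k') z * starRingEnd ℂ ((k - k') z) = 0 := by
    have : (fun z => (k - k') z * starRingEnd ℂ ((k - k') z)) = fun z =>
        (k - k') z * starRingEnd ℂ (k z) - (k - k') z * starRingEnd ℂ (k' z) := by
      ext z; simp only [Pi.sub_apply, map_sub]; ring
    rw [this, integral_sub (hstar hk.1) (hstar hk'.1), ← hk.2 _ hd, ← hk'.2 _ hd, sub_self]
  simp only [Complex.mul_conj] at h1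
  rw [integral_complex_ofReal, Complex.ofReal_eq_zero, integral_eq_zero_iff_of_nonneg] at h1
  · have hae : k =ᵐ[volume.restrict Ω] k' := by
      filter_upwards [h1] with z hz
      exact sub_eq_zero.1 (Complex.normSq_eq_zero.1 hz)
    exact Measure.eqOn_open_of_ae_eq hae hΩ hk.1.1.continuousOn hk'.1.1.continuousOn
  · exact fun z => Complex.normSq_nonneg _
  · refine (hstar hd).re.congr (Eventually.of_forall fun z => ?_)
    simp only [Complex.mul_conj]
    exact Complex.ofReal_re _

theorem bergmanKernel_eq_of_isReproducingAt {Ω : Set (Fin n → ℂ)} (hΩ : IsOpen Ω)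
    {p : Fin n → ℂ} {k : (Fin n → ℂ) → ℂ} (hk : IsReproducingAt Ω p k) {z : Fin n → ℂ}
    (hz : z ∈ Ω) : bergmanKernel Ω z p = k z := by
  have hex : ∃ k, IsReproducingAt Ω p k := ⟨k, hk⟩
  rw [bergmanKernel, dif_pos hex]
  exact hex.choose_spec.eqOn hΩ hk hz

/-- The reproducing kernel at the preimage of the center of the unit ball. -/
theorem IsBiholomorphism.isReproducingAt {F G : (Fin n → ℂ) → (Fin n → ℂ)}
    {Ω : Set (Fin n → ℂ)} (h : IsBiholomorphism F G Ω (euclideanBall 0 1)) (hΩ : IsOpen Ω)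
    {t : Fin n → ℂ} (ht : t ∈ Ω) (hFt : F t = 0) :
    IsReproducingAt Ω t fun z => (volume.real (euclideanBall (0 : Fin n → ℂ) 1) : ℂ)⁻¹ *
      complexJacobian F z * starRingEnd ℂ (complexJacobian F t) := by
  set V := volume.real (euclideanBall (0 : Fin n → ℂ) 1) with hV
  have hV0 : (V : ℂ) ≠ 0 := by exact_mod_cast volume_real_unitBall_pos.ne'
  have hBo : IsOpen (euclideanBall (0 : Fin n → ℂ) 1) := isOpen_euclideanBall 0 1
  have hJ := differentiableOn_complexJacobian hΩ h.holomorphic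
  have hJ0 : ∀ z ∈ Ω, complexJacobian F z ≠ 0 := fun z hz => h.complexJacobian_ne_zero hΩ hBo hz
  have hJL : MemLp (complexJacobian F) 2 (volume.restrict Ω) := by
    rw [memLp_two_iff_integrable_sq_norm
      (hJ.continuousOn.aestronglyMeasurable hΩ.measurableSet)]
    -- `|J|²` is the pull-back of the constant `1`, and the ball has finite volume.
    have : IntegrableOn (fun _ => (1 : ℝ)) (euclideanBall (0 : Fin n → ℂ) 1) :=
      integrableOn_const volume_unitBall_lt_top.ne
    simpa [IntegrableOn] using (h.integrableOn_iff hΩ _).1 this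
  refine ⟨⟨(hJ.const_mul _).mul_const _, ?_⟩, fun f hf => ?_⟩
  · exact (hJL.const_mul _).mul_const _
  -- With this weight, the pull-back of `g` times `|J|²` is `f · conj J`. The mean value property of
  -- `g` then reads `∫ f · conj J = V f(t) / J(t)`.
  · set g : (Fin n → ℂ) → ℂ := fun w => f (G w) * (complexJacobian F (G w))⁻¹ with hg
    have hgd : DifferentiableOn ℂ g (euclideanBall 0 1) :=
      (hf.1.comp h.holomorphic_inv h.mapsTo_inv).mul
        ((hJ.comp h.holomorphic_inv h.mapsTo_inv).inv fun w hw => hJ0 _ (h.mapsTo_inv hw))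
    have hpull : EqOn (fun z => ‖complexJacobian F z‖ ^ 2 • g (F z))
        (fun z => f z * starRingEnd ℂ (complexJacobian F z)) Ω := fun z hz => by
      simp only [hg, h.invOn.1 hz, Complex.real_smul]
      rw [← Complex.normSq_eq_norm_sq, ← Complex.mul_conj]
      have := hJ0 z hz
      field_simp
    have hgi : IntegrableOn g (euclideanBall 0 1) := by
      rw [h.integrableOn_iff hΩ, integrableOn_congr_fun hpull hΩ.measurableSet]
      exact hf.2.integrable_mul hJL.star
    have key := integral_unitBall_eq hgd hgi
    rw [h.integral_eq hΩ, setIntegral_congr_fun hΩ.measurableSet hpull] at key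
    have hG0 : G 0 = t := by rw [← hFt]; exact h.invOn.1 ht
    simp only [hg, hG0, ← hV] at key
    have e : ∀ z, f z * starRingEnd ℂ ((V : ℂ)⁻¹ * complexJacobian F z *
        starRingEnd ℂ (complexJacobian F t)) =
        ((V : ℂ)⁻¹ * complexJacobian F t) * (f z * starRingEnd ℂ (complexJacobian F z)) :=
      fun z => by
        simp only [map_mul, map_inv₀, Complex.conj_ofReal, Complex.conj_conj]; ring
    simp only [e]
    rw [integral_const_mul, key]
    have := hJ0 t ht
    field_simp

theorem isBiholomorphism_ballInvolution {a : Fin n → ℂ} (ha : a ∈ euclideanBall 0 1) :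
    IsBiholomorphism (ballInvolution a) (ballInvolution a)
      (euclideanBall 0 1) (euclideanBall 0 1) := by
  have hd : DifferentiableOn ℂ (ballInvolution a) (euclideanBall 0 1) := fun z hz => by
    obtain ⟨L, hL, -⟩ := hasFDerivAt_ballInvolution ha hz
    exact hL.differentiableAt.differentiableWithinAt
  exact ⟨fun z hz => ballInvolution_mem ha hz, fun z hz => ballInvolution_mem ha hz,
    ⟨fun z hz => ballInvolution_ballInvolution ha hz,
      fun z hz => ballInvolution_ballInvolution ha hz⟩, hd, hd⟩

theorem complexJacobian_ballInvolution {a z : Fin n → ℂ} (ha : a ∈ euclideanBall 0 1)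
    (hz : z ∈ euclideanBall 0 1) : complexJacobian (ballInvolution a) z =
      (-1) ^ n * ((√(1 - ∑ i, ‖a i‖ ^ 2) : ℝ) / (1 - z ⬝ᵥ star a)) ^ (n + 1) := by
  obtain ⟨L, hL, hdet⟩ := hasFDerivAt_ballInvolution ha hz
  rw [complexJacobian, hL.fderiv, hdet]

/-- The Bergman kernel of a domain biholomorphic to the unit ball. -/
theorem IsBiholomorphism.bergmanKernel_eq {F G : (Fin n → ℂ) → (Fin n → ℂ)}
    {Ω : Set (Fin n → ℂ)} (h : IsBiholomorphism F G Ω (euclideanBall 0 1)) (hΩ : IsOpen Ω)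
    {z t : Fin n → ℂ} (hz : z ∈ Ω) (ht : t ∈ Ω) :
    bergmanKernel Ω z t = (volume.real (euclideanBall (0 : Fin n → ℂ) 1) : ℂ)⁻¹ *
      complexJacobian F z * starRingEnd ℂ (complexJacobian F t) *
        ((1 - F z ⬝ᵥ star (F t)) ^ (n + 1))⁻¹ := by
  have ha := h.mapsTo ht
  have hFz := h.mapsTo hz
  have hφ := isBiholomorphism_ballInvolution ha
  have hBo : IsOpen (euclideanBall (0 : Fin n → ℂ) 1) := isOpen_euclideanBall 0 1
  -- After the involution that moves `F t` to `0`, the kernel at `t` is a product of Jacobians. The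
  -- powers of `s` from `F z` and from `F t` cancel, and the two signs `(-1)^n` multiply to `1`.
  have hrep := (h.trans hφ).isReproducingAt hΩ ht (ballInvolution_self ha)
  rw [bergmanKernel_eq_of_isReproducingAt hΩ hrep hz]
  have hdF : ∀ w ∈ Ω, DifferentiableAt ℂ F w := fun w hw =>
    h.holomorphic.differentiableAt (hΩ.mem_nhds hw)
  have hdφ : ∀ w ∈ Ω, DifferentiableAt ℂ (ballInvolution (F t)) (F w) := fun w hw =>
    hφ.holomorphic.differentiableAt (hBo.mem_nhds (h.mapsTo hw))
  rw [complexJacobian_comp (hdF z hz) (hdφ z hz), complexJacobian_comp (hdF t ht) (hdφ t ht),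
    complexJacobian_ballInvolution ha hFz, complexJacobian_ballInvolution ha ha]
  obtain ⟨s, hs, hs', hsa⟩ := exists_sqrt_one_sub ha
  have hs0 : (s : ℂ) ≠ 0 := by exact_mod_cast hs.ne'
  rw [← hs', hsa, sub_sub_cancel]
  have e : (s : ℂ) / s ^ 2 = (s : ℂ)⁻¹ := by field_simp
  have e2 : ((-1 : ℂ)) ^ n * (-1) ^ n = 1 := by rw [← mul_pow]; simp
  simp only [map_mul, map_pow, map_neg, map_one, e, map_inv₀, Complex.conj_ofReal, div_pow,
    inv_pow]
  have := one_sub_dotProduct_star_ne_zero hFz ha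
  field_simp
  linear_combination ((volume.real (euclideanBall (0 : Fin n → ℂ) 1) : ℂ)⁻¹ *
    complexJacobian F z * starRingEnd ℂ (complexJacobian F t)) * e2

end Kernel

/-! ### Wirtinger calculus -/

section Wirtinger

variable {n : ℕ}

/-- `f` is real differentiable at `z` and `(∂/∂x_j + c ∂/∂y_j) f (z) / 2 = f'`; the cases `c = -i`
and `c = i` are the two Wirtinger derivatives. -/
structure HasWirtinger (c : ℂ) (j : Fin n) (f : (Fin n → ℂ) → ℂ) (f' : ℂ) (z : Fin n → ℂ) :
    Prop where
  differentiableAt : DifferentiableAt ℝ f z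
  eq : (fderiv ℝ f z (Pi.single j 1) + c * fderiv ℝ f z (Pi.single j Complex.I)) / 2 = f'

variable {c : ℂ} {j : Fin n} {f g : (Fin n → ℂ) → ℂ} {f' g' : ℂ} {z : Fin n → ℂ}

theorem HasWirtinger.wirtinger_eq (h : HasWirtinger (-Complex.I) j f f' z) :
    wirtinger j f z = f' := by
  rw [← h.eq, wirtinger]; ring

theorem HasWirtinger.wirtingerBar_eq (h : HasWirtinger Complex.I j f f' z) :
    wirtingerBar j f z = f' := h.eq

theorem HasWirtinger.congr (h : HasWirtinger c j f f' z) (hfg : g =ᶠ[𝓝 z] f) :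
    HasWirtinger c j g f' z :=
  ⟨h.differentiableAt.congr_of_eventuallyEq hfg, by rw [hfg.fderiv_eq, h.eq]⟩

theorem HasWirtinger.const (a : ℂ) : HasWirtinger c j (fun _ => a) 0 z :=
  ⟨by fun_prop, by simp⟩

theorem HasWirtinger.add (hf : HasWirtinger c j f f' z) (hg : HasWirtinger c j g g' z) :
    HasWirtinger c j (fun t => f t + g t) (f' + g') z := by
  refine ⟨hf.1.add hg.1, ?_⟩
  rw [fderiv_fun_add hf.1 hg.1, ← hf.eq, ← hg.eq]
  simp only [add_apply]
  ring

theorem HasWirtinger.sum {ι : Type*} {s : Finset ι} {f : ι → (Fin n → ℂ) → ℂ} {f' : ι → ℂ}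
    (h : ∀ i ∈ s, HasWirtinger c j (f i) (f' i) z) :
    HasWirtinger c j (fun t => ∑ i ∈ s, f i t) (∑ i ∈ s, f' i) z := by
  classical
  induction s using Finset.induction_on with
  | empty => simpa using HasWirtinger.const 0
  | insert i s hi ih =>
    simp only [Finset.sum_insert hi]
    exact (h i (Finset.mem_insert_self i s)).add
      (ih fun k hk => h k (Finset.mem_insert_of_mem hk))

theorem HasWirtinger.mul (hf : HasWirtinger c j f f' z) (hg : HasWirtinger c j g g' z) :
    HasWirtinger c j (fun t => f t * g t) (f' * g z + f z * g') z := by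
  refine ⟨hf.1.mul hg.1, ?_⟩
  rw [fderiv_fun_mul hf.1 hg.1, ← hf.eq, ← hg.eq]
  simp only [add_apply, smul_apply, smul_eq_mul]
  ring

/-- The outer function is holomorphic, so the chain rule has no conjugate term, whatever `c` is. -/
theorem HasWirtinger.comp {φ : ℂ → ℂ} {φ' : ℂ} (hf : HasWirtinger c j f f' z)
    (hφ : HasDerivAt φ φ' (f z)) : HasWirtinger c j (fun t => φ (f t)) (φ' * f') z := by
  have h1 : HasFDerivAt (fun t => φ (f t)) _ z :=
    (hφ.hasFDerivAt.restrictScalars ℝ).comp z hf.1.hasFDerivAt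
  refine ⟨h1.differentiableAt, ?_⟩
  rw [h1.fderiv, ← hf.eq]
  simp
  ring

/-- By complex linearity the derivative along `i e_j` is `i` times that along `e_j`; the factor `(1
+ c i) / 2` is `1` for `c = -i` and `0` for `c = i`. Conjugation exchanges the two cases in the next
lemma. -/
theorem DifferentiableAt.hasWirtinger (hf : DifferentiableAt ℂ f z) :
    HasWirtinger (-Complex.I) j f (fderiv ℂ f z (Pi.single j 1)) z ∧
      HasWirtinger Complex.I j f 0 z := by
  have h1 := hf.hasFDerivAt.restrictScalars ℝ
  have h2 : (Pi.single j Complex.I : Fin n → ℂ) = Complex.I • Pi.single j 1 := by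
    rw [← Pi.single_smul', smul_eq_mul, mul_one]
  refine ⟨⟨h1.differentiableAt, ?_⟩, ⟨h1.differentiableAt, ?_⟩⟩ <;>
  · rw [h1.fderiv, ContinuousLinearMap.coe_restrictScalars', h2, map_smul, smul_eq_mul]
    ring_nf
    rw [Complex.I_sq]
    ring

theorem DifferentiableAt.hasWirtinger_conj (hf : DifferentiableAt ℂ f z) :
    HasWirtinger (-Complex.I) j (fun t => starRingEnd ℂ (f t)) 0 z ∧
      HasWirtinger Complex.I j (fun t => starRingEnd ℂ (f t))
        (starRingEnd ℂ (fderiv ℂ f z (Pi.single j 1))) z := by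
  have h1 : HasFDerivAt (fun t => starRingEnd ℂ (f t)) _ z :=
    (Complex.conjCLE.toContinuousLinearMap.hasFDerivAt).comp z
      (hf.hasFDerivAt.restrictScalars ℝ)
  have h2 : (Pi.single j Complex.I : Fin n → ℂ) = Complex.I • Pi.single j 1 := by
    rw [← Pi.single_smul', smul_eq_mul, mul_one]
  refine ⟨⟨h1.differentiableAt, ?_⟩, ⟨h1.differentiableAt, ?_⟩⟩ <;>
  · rw [h1.fderiv]
    simp only [ContinuousLinearMap.comp_apply, ContinuousLinearMap.coe_restrictScalars', h2,
      map_smul, smul_eq_mul, ContinuousLinearEquiv.coe_coe, Complex.conjCLE_apply, map_mul,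
      Complex.conj_I]
    generalize starRingEnd ℂ (fderiv ℂ f z (Pi.single j 1)) = w
    ring_nf
    rw [Complex.I_sq]
    ring

end Wirtinger

/-! ### Bergman metric and representative coordinate in the ball model -/

section BallModel

theorem hasDerivAt_inv_pow_succ {q : ℂ} (hq : q ≠ 0) (n : ℕ) :
    HasDerivAt (fun x : ℂ => (x ^ (n + 1))⁻¹) (-((n + 1) * (q ^ (n + 2))⁻¹)) q := by
  refine ((hasDerivAt_pow (n + 1) q).fun_inv (pow_ne_zero _ hq)).congr_deriv ?_
  rw [add_tsub_cancel_right]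
  push_cast
  field_simp
  ring

variable {n : ℕ} {F G : (Fin n → ℂ) → (Fin n → ℂ)} {Ω : Set (Fin n → ℂ)}

theorem IsBiholomorphism.bergmanKernel_conj_symm (h : IsBiholomorphism F G Ω (euclideanBall 0 1))
    (hΩ : IsOpen Ω) {z t : Fin n → ℂ} (hz : z ∈ Ω) (ht : t ∈ Ω) :
    bergmanKernel Ω z t = starRingEnd ℂ (bergmanKernel Ω t z) := by
  rw [h.bergmanKernel_eq hΩ hz ht, h.bergmanKernel_eq hΩ ht hz]
  have := dotProduct_star_comm (F t) (F z)
  rw [Complex.star_def] at this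
  simp only [map_mul, map_inv₀, map_pow, map_sub, map_one, this, Complex.conj_ofReal,
    Complex.conj_conj]
  ring

theorem IsBiholomorphism.bergmanKernel_ne_zero (h : IsBiholomorphism F G Ω (euclideanBall 0 1))
    (hΩ : IsOpen Ω) {z t : Fin n → ℂ} (hz : z ∈ Ω) (ht : t ∈ Ω) :
    bergmanKernel Ω z t ≠ 0 := by
  have hJ0 : ∀ z ∈ Ω, complexJacobian F z ≠ 0 := fun z hz =>
    h.complexJacobian_ne_zero hΩ (isOpen_euclideanBall 0 1) hz
  have hV0 : (volume.real (euclideanBall (0 : Fin n → ℂ) 1) : ℂ) ≠ 0 := by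
    exact_mod_cast volume_real_unitBall_pos.ne'
  have := one_sub_dotProduct_star_ne_zero (h.mapsTo hz) (h.mapsTo ht)
  have h1 := hJ0 z hz
  have h2 : starRingEnd ℂ (complexJacobian F t) ≠ 0 := by
    rw [map_ne_zero]; exact hJ0 t ht
  rw [h.bergmanKernel_eq hΩ hz ht]
  positivity

/-- The logarithmic derivative of the Bergman kernel in the holomorphic variable. -/
theorem IsBiholomorphism.fderiv_bergmanKernel (h : IsBiholomorphism F G Ω (euclideanBall 0 1))
    (hΩ : IsOpen Ω) {z t : Fin n → ℂ} (hz : z ∈ Ω) (ht : t ∈ Ω) (v : Fin n → ℂ) :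
    DifferentiableAt ℂ (fun ζ => bergmanKernel Ω ζ t) z ∧
    fderiv ℂ (fun ζ => bergmanKernel Ω ζ t) z v = bergmanKernel Ω z t *
      (fderiv ℂ (complexJacobian F) z v / complexJacobian F z +
        (n + 1) * (fderiv ℂ F z v ⬝ᵥ star (F t)) / (1 - F z ⬝ᵥ star (F t))) := by
  have hJ : HasFDerivAt (complexJacobian F) (fderiv ℂ (complexJacobian F) z) z :=
    ((differentiableOn_complexJacobian hΩ h.holomorphic).differentiableAt
      (hΩ.mem_nhds hz)).hasFDerivAt
  have hF : HasFDerivAt F (fderiv ℂ F z) z :=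
    (h.holomorphic.differentiableAt (hΩ.mem_nhds hz)).hasFDerivAt
  have hD0 := one_sub_dotProduct_star_ne_zero (h.mapsTo hz) (h.mapsTo ht)
  have hJ0 := h.complexJacobian_ne_zero hΩ (isOpen_euclideanBall 0 1) hz
  let φ : (Fin n → ℂ) →L[ℂ] ℂ :=
    LinearMap.toContinuousLinearMap
      { toFun := fun x => x ⬝ᵥ star (F t)
        map_add' := fun x y => add_dotProduct _ _ _
        map_smul' := fun c x => smul_dotProduct _ _ _ }
  have hD : HasFDerivAt (fun ζ => 1 - F ζ ⬝ᵥ star (F t)) (-(φ.comp (fderiv ℂ F z))) z :=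
    (φ.hasFDerivAt.comp z hF).const_sub 1
  have hP := (hasDerivAt_inv_pow_succ hD0 n).comp_hasFDerivAt z hD
  have hK := ((hJ.const_mul (volume.real (euclideanBall (0 : Fin n → ℂ) 1) : ℂ)⁻¹).mul_const
    (starRingEnd ℂ (complexJacobian F t))).mul hP
  have hev : (fun ζ => bergmanKernel Ω ζ t) =ᶠ[𝓝 z] fun ζ =>
      (volume.real (euclideanBall (0 : Fin n → ℂ) 1) : ℂ)⁻¹ *
      complexJacobian F ζ * starRingEnd ℂ (complexJacobian F t) *
        ((1 - F ζ ⬝ᵥ star (F t)) ^ (n + 1))⁻¹ := by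
    filter_upwards [hΩ.mem_nhds hz] with ζ hζ using h.bergmanKernel_eq hΩ hζ ht
  have hK' := hK.congr_of_eventuallyEq hev
  refine ⟨hK'.differentiableAt, ?_⟩
  rw [hK'.fderiv, h.bergmanKernel_eq hΩ hz ht]
  have hφ : φ (fderiv ℂ F z v) = fderiv ℂ F z v ⬝ᵥ star (F t) := rfl
  simp only [add_apply, smul_apply, neg_apply, ContinuousLinearMap.comp_apply, hφ, smul_eq_mul,
    Function.comp_apply]
  field_simp
  ring

/-- The first Wirtinger derivatives of `t ↦ log K(t, t)`. -/
theorem IsBiholomorphism.wirtingerBar_logBergmanDiag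
    (h : IsBiholomorphism F G Ω (euclideanBall 0 1)) (hΩ : IsOpen Ω) {t : Fin n → ℂ}
    (ht : t ∈ Ω) (j : Fin n) :
    wirtingerBar j (logBergmanDiag Ω) t =
      starRingEnd ℂ (fderiv ℂ (complexJacobian F) t (Pi.single j 1) / complexJacobian F t) +
        (n + 1) * (∑ k, F t k * starRingEnd ℂ (fderiv ℂ F t (Pi.single j 1) k)) *
          (1 + -1 * ∑ k, F t k * starRingEnd ℂ (F t k))⁻¹ := by
  have hF : ∀ k, DifferentiableAt ℂ (fun t => F t k) t := fun k =>
    differentiableAt_pi.1 (h.holomorphic.differentiableAt (hΩ.mem_nhds ht)) k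
  have hJ : DifferentiableAt ℂ (complexJacobian F) t :=
    (differentiableOn_complexJacobian hΩ h.holomorphic).differentiableAt (hΩ.mem_nhds ht)
  have hdot : ∀ t, 1 + -1 * ∑ k, F t k * starRingEnd ℂ (F t k) = 1 - F t ⬝ᵥ star (F t) :=
    fun t => by simp [dotProduct, sub_eq_add_neg]
  -- The sum and product rules produce `1 - |F|²` in the form `1 + -1 * ∑`, which is why the
  -- statement has this shape.
  have hq : HasWirtinger Complex.I j (fun t => 1 + -1 * ∑ k, F t k * starRingEnd ℂ (F t k)) _ t :=
    (HasWirtinger.const 1).add ((HasWirtinger.const (-1)).mul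
      (HasWirtinger.sum fun k _ => ((hF k).hasWirtinger.2).mul (hF k).hasWirtinger_conj.2))
  have hq0 : 1 + -1 * ∑ k, F t k * starRingEnd ℂ (F t k) ≠ 0 := by
    rw [hdot]; exact one_sub_dotProduct_star_ne_zero (h.mapsTo ht) (h.mapsTo ht)
  have hP := hq.comp (hasDerivAt_inv_pow_succ hq0 n)
  have hu := (((HasWirtinger.const (volume.real (euclideanBall (0 : Fin n → ℂ) 1) : ℂ)⁻¹).mul
    hJ.hasWirtinger.2).mul hJ.hasWirtinger_conj.2).mul hP
  have hpos : ∀ t ∈ Ω, ∃ x : ℝ, 0 < x ∧ bergmanKernel Ω t t = x := fun t ht => by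
    refine ⟨(volume.real (euclideanBall (0 : Fin n → ℂ) 1))⁻¹ * ‖complexJacobian F t‖ ^ 2 *
      ((1 - ∑ i, ‖F t i‖ ^ 2) ^ (n + 1))⁻¹, ?_, ?_⟩
    · have h1 := norm_pos_iff.2 (h.complexJacobian_ne_zero hΩ (isOpen_euclideanBall 0 1) ht)
      have h2 := volume_real_unitBall_pos (n := n)
      have h3 : 0 < 1 - ∑ i, ‖F t i‖ ^ 2 := sub_pos.2 (mem_unitBall.1 (h.mapsTo ht))
      positivity
    · rw [h.bergmanKernel_eq hΩ ht ht, dotProduct_star_self, mul_assoc _ (complexJacobian F t),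
        Complex.mul_conj, Complex.normSq_eq_norm_sq]
      push_cast
      ring
  have hKu : ∀ t ∈ Ω, bergmanKernel Ω t t = (volume.real (euclideanBall (0 : Fin n → ℂ) 1) : ℂ)⁻¹ *
      complexJacobian F t * starRingEnd ℂ (complexJacobian F t) *
        ((1 + -1 * ∑ k, F t k * starRingEnd ℂ (F t k)) ^ (n + 1))⁻¹ := fun t ht => by
    rw [h.bergmanKernel_eq hΩ ht ht, hdot]
  -- Since `K(t, t)` is positive, the real logarithm agrees with the complex one, to which the
  -- holomorphic chain rule applies.
  have hlog : logBergmanDiag Ω =ᶠ[𝓝 t] fun t =>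
      Complex.log ((volume.real (euclideanBall (0 : Fin n → ℂ) 1) : ℂ)⁻¹ *
      complexJacobian F t * starRingEnd ℂ (complexJacobian F t) *
        ((1 + -1 * ∑ k, F t k * starRingEnd ℂ (F t k)) ^ (n + 1))⁻¹) := by
    filter_upwards [hΩ.mem_nhds ht] with s hs
    obtain ⟨x, hx, hxe⟩ := hpos s hs
    rw [← hKu s hs, logBergmanDiag, hxe, Complex.ofReal_re, Complex.ofReal_log hx.le]
  have hslit : (volume.real (euclideanBall (0 : Fin n → ℂ) 1) : ℂ)⁻¹ *
      complexJacobian F t * starRingEnd ℂ (complexJacobian F t) *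
        ((1 + -1 * ∑ k, F t k * starRingEnd ℂ (F t k)) ^ (n + 1))⁻¹ ∈ Complex.slitPlane := by
    obtain ⟨x, hx, hxe⟩ := hpos t ht
    rw [← hKu t ht, hxe]
    exact Complex.ofReal_mem_slitPlane.2 hx
  rw [((hu.comp (Complex.hasDerivAt_log hslit)).congr hlog).wirtingerBar_eq]
  have hJ0 := h.complexJacobian_ne_zero hΩ (isOpen_euclideanBall 0 1) ht
  have hJ0' : starRingEnd ℂ (complexJacobian F t) ≠ 0 := by rwa [map_ne_zero]
  have hV0 : (volume.real (euclideanBall (0 : Fin n → ℂ) 1) : ℂ) ≠ 0 := by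
    exact_mod_cast volume_real_unitBall_pos.ne'
  have hFk : ∀ k v, fderiv ℂ (fun t => F t k) t v = fderiv ℂ F t v k := fun k v => by
    rw [fderiv_apply (h.holomorphic.differentiableAt (hΩ.mem_nhds ht))]; rfl
  simp only [hFk, zero_mul, zero_add, mul_zero, add_zero, map_div₀]
  generalize 1 + -1 * ∑ k, F t k * starRingEnd ℂ (F t k) = q at *
  field_simp
  ring

/-- In `∂ ∂̄ log K` the Jacobian contributes an antiholomorphic term, killed by `∂`. Since `F p =
0`, of the rest only the term in which `∂` hits the holomorphic factor `F_k` survives, with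
denominator `1`. -/
theorem IsBiholomorphism.bergmanMetric_eq
    (h : IsBiholomorphism F G Ω (euclideanBall 0 1)) (hΩ : IsOpen Ω) {p : Fin n → ℂ}
    (hp : p ∈ Ω) (hFp : F p = 0) (α β : Fin n) :
    bergmanMetric Ω p α β = (n + 1) * ∑ k, fderiv ℂ F p (Pi.single α 1) k *
      starRingEnd ℂ (fderiv ℂ F p (Pi.single β 1) k) := by
  have hFd := h.holomorphic.differentiableAt (hΩ.mem_nhds hp)
  have hF : ∀ k, DifferentiableAt ℂ (fun t => F t k) p := differentiableAt_pi.1 hFd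
  have hF' : ∀ k, DifferentiableAt ℂ (fun t => fderiv ℂ F t (Pi.single β 1) k) p := fun k =>
    (differentiableOn_fderiv_apply_pi hΩ h.holomorphic _ k).differentiableAt (hΩ.mem_nhds hp)
  have hJo := differentiableOn_complexJacobian hΩ h.holomorphic
  have hJ : DifferentiableAt ℂ (fun t => fderiv ℂ (complexJacobian F) t (Pi.single β 1) /
      complexJacobian F t) p := by
    simp only [div_eq_mul_inv]
    exact ((differentiableOn_fderiv_apply hΩ hJo _).differentiableAt (hΩ.mem_nhds hp)).mul
      ((hJo.differentiableAt (hΩ.mem_nhds hp)).inv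
        (h.complexJacobian_ne_zero hΩ (isOpen_euclideanBall 0 1) hp))
  have hq : HasWirtinger (-Complex.I) α
      (fun t => 1 + -1 * ∑ k, F t k * starRingEnd ℂ (F t k)) _ p :=
    (HasWirtinger.const 1).add ((HasWirtinger.const (-1)).mul
      (HasWirtinger.sum fun k _ => ((hF k).hasWirtinger.1).mul (hF k).hasWirtinger_conj.1))
  have hq0 : 1 + -1 * ∑ k, F p k * starRingEnd ℂ (F p k) ≠ 0 := by simp [hFp]
  have hmain := (hJ.hasWirtinger_conj (j := α)).1.add
    (((HasWirtinger.const ((n : ℂ) + 1)).mul (HasWirtinger.sum (s := Finset.univ) fun k _ =>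
      ((hF k).hasWirtinger (j := α)).1.mul (hF' k).hasWirtinger_conj.1)).mul
        (hq.comp (hasDerivAt_inv hq0)))
  have hev : wirtingerBar β (logBergmanDiag Ω) =ᶠ[𝓝 p] fun t =>
      starRingEnd ℂ (fderiv ℂ (complexJacobian F) t (Pi.single β 1) / complexJacobian F t) +
        (n + 1) * (∑ k, F t k * starRingEnd ℂ (fderiv ℂ F t (Pi.single β 1) k)) *
          (1 + -1 * ∑ k, F t k * starRingEnd ℂ (F t k))⁻¹ := by
    filter_upwards [hΩ.mem_nhds hp] with t ht using h.wirtingerBar_logBergmanDiag hΩ ht β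
  have hFk : ∀ k v, fderiv ℂ (fun t => F t k) p v = fderiv ℂ F p v k := fun k v => by
    rw [fderiv_apply hFd]; rfl
  rw [bergmanMetric, Matrix.of_apply, (hmain.congr hev).wirtinger_eq]
  simp [hFp, hFk]

/-- Relative to the preimage `p` of the center, the representative coordinate is the given
biholomorphism followed by the inverse of its derivative at `p`. -/
theorem IsBiholomorphism.bergmanRep_eq
    (h : IsBiholomorphism F G Ω (euclideanBall 0 1)) (hΩ : IsOpen Ω) {p : Fin n → ℂ}
    (hp : p ∈ Ω) (hFp : F p = 0) {z : Fin n → ℂ} (hz : z ∈ Ω) :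
    bergmanRep Ω p z = fderiv ℂ G 0 (F z) := by
  have hBo : IsOpen (euclideanBall (0 : Fin n → ℂ) 1) := isOpen_euclideanBall 0 1
  set A : Matrix (Fin n) (Fin n) ℂ := Matrix.of fun i j => fderiv ℂ F p (Pi.single j 1) i with hA
  have hAJ : A.det ≠ 0 := by
    rw [hA, ← complexJacobian_eq_det]; exact h.complexJacobian_ne_zero hΩ hBo hp
  have hg : bergmanMetric Ω p = ((n : ℂ) + 1) • (A.transpose * A.map (starRingEnd ℂ)) := by
    ext α β
    rw [h.bergmanMetric_eq hΩ hp hFp]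
    simp [Matrix.mul_apply, hA]
  have hn : ((n : ℂ) + 1) ≠ 0 := by exact_mod_cast n.succ_ne_zero
  have hgdet : IsUnit (bergmanMetric Ω p).det := by
    rw [hg, Matrix.det_smul, Matrix.det_mul, Matrix.det_transpose, isUnit_iff_ne_zero]
    refine mul_ne_zero (pow_ne_zero _ hn) (mul_ne_zero hAJ ?_)
    have := RingHom.map_det (starRingEnd ℂ) A
    rw [RingHom.mapMatrix_apply] at this
    rw [← this, map_ne_zero]
    exact hAJ
  set w := fderiv ℂ G 0 (F z) with hw
  have hAw : A.mulVec w = F z := by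
    have h1 := h.symm.fderiv_comp_fderiv hBo hΩ zero_mem_unitBall
    have hG0 : G 0 = p := by rw [← hFp]; exact h.invOn.1 hp
    rw [hG0] at h1
    have h2 := congrArg (fun L : (Fin n → ℂ) →L[ℂ] (Fin n → ℂ) => L (F z)) h1
    simp only [ContinuousLinearMap.comp_apply, ContinuousLinearMap.id_apply, ← hw] at h2
    rw [← h2]
    have h3 : A = LinearMap.toMatrix' (fderiv ℂ F p : (Fin n → ℂ) →ₗ[ℂ] (Fin n → ℂ)) := rfl
    rw [h3, LinearMap.toMatrix'_mulVec]
    rfl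
  have hK := h.bergmanKernel_ne_zero hΩ hz hp
  -- The logarithmic derivatives of `J` cancel. What remains is `(n + 1) ∑ F_k(z) conj(∂_j F_k(p))`,
  -- and as `F z = A w` this is the row vector `w` times the metric; the inverse metric then returns
  -- `w`.
  have hbar : ∀ j, (bergmanKernel Ω z p)⁻¹ * wirtingerBar j (fun t => bergmanKernel Ω z t) p
      - wirtingerBar j (logBergmanDiag Ω) p = (Matrix.vecMul w (bergmanMetric Ω p)) j := fun j => by
    have hd := h.fderiv_bergmanKernel hΩ hp hz (Pi.single j 1)
    have hev : (fun t => bergmanKernel Ω z t) =ᶠ[𝓝 p]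
        fun t => starRingEnd ℂ (bergmanKernel Ω t z) := by
      filter_upwards [hΩ.mem_nhds hp] with t ht using h.bergmanKernel_conj_symm hΩ hz ht
    rw [((hd.1.hasWirtinger_conj (j := j)).2.congr hev).wirtingerBar_eq, hd.2, map_mul,
      ← h.bergmanKernel_conj_symm hΩ hz hp, inv_mul_cancel_left₀ hK,
      h.wirtingerBar_logBergmanDiag hΩ hp, hg, Matrix.vecMul_smul, ← Matrix.vecMul_vecMul,
      Matrix.vecMul_transpose, hAw]
    simp [hFp, dotProduct, Matrix.vecMul, hA, mul_comm]
  ext α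
  rw [bergmanRep]
  simp only [hbar]
  have : Matrix.vecMul (Matrix.vecMul w (bergmanMetric Ω p)) (bergmanMetric Ω p)⁻¹ = w := by
    rw [Matrix.vecMul_vecMul, Matrix.mul_nonsing_inv _ hgdet, Matrix.vecMul_one]
  rw [← congrFun this α, Matrix.vecMul, dotProduct]
  exact Finset.sum_congr rfl fun j _ => mul_comm _ _

/-- The Hermitian form of the metric at `w` is `(n + 1) |F'(p) w|²`, so the radius `n + 1`
corresponds to the unit ball. -/
theorem IsBiholomorphism.mem_bergmanBall
    (h : IsBiholomorphism F G Ω (euclideanBall 0 1)) (hΩ : IsOpen Ω) {p : Fin n → ℂ}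
    (hp : p ∈ Ω) (hFp : F p = 0) (w : Fin n → ℂ) :
    w ∈ bergmanBall Ω p ↔ fderiv ℂ F p w ∈ euclideanBall 0 1 := by
  have hsum : fderiv ℂ F p w = ∑ α, w α • fderiv ℂ F p (Pi.single α 1) := by
    conv_lhs => rw [pi_eq_sum_univ' w]
    simp only [map_sum, map_smul]
  have key : ∑ α, ∑ β, w α * bergmanMetric Ω p α β * starRingEnd ℂ (w β) =
      (n + 1) * (fderiv ℂ F p w ⬝ᵥ star (fderiv ℂ F p w)) := by
    set a : Fin n → Fin n → ℂ := fun α k => fderiv ℂ F p (Pi.single α 1) k with ha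
    have hl : ∀ α β, w α * bergmanMetric Ω p α β * starRingEnd ℂ (w β) =
        ∑ k, (n + 1) * ((w α * a α k) * starRingEnd ℂ (w β * a β k)) := fun α β => by
      rw [h.bergmanMetric_eq hΩ hp hFp, Finset.mul_sum, Finset.mul_sum, Finset.sum_mul]
      refine Finset.sum_congr rfl fun k _ => ?_
      rw [map_mul]
      ring
    have hr : ∀ k, fderiv ℂ F p w k * starRingEnd ℂ (fderiv ℂ F p w k) =
        ∑ α, ∑ β, (w α * a α k) * starRingEnd ℂ (w β * a β k) := fun k => by
      rw [hsum, Finset.sum_apply, map_sum, Finset.sum_mul_sum]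
      rfl
    calc _ = ∑ α, ∑ k, ∑ β, ((n : ℂ) + 1) * ((w α * a α k) * starRingEnd ℂ (w β * a β k)) := by
          refine Finset.sum_congr rfl fun α _ => ?_
          rw [Finset.sum_comm]
          exact Finset.sum_congr rfl fun β _ => hl α β
      _ = ∑ k, ((n : ℂ) + 1) * (fderiv ℂ F p w k * starRingEnd ℂ (fderiv ℂ F p w k)) := by
          rw [Finset.sum_comm]
          refine Finset.sum_congr rfl fun k _ => ?_
          simp only [hr, Finset.mul_sum]
      _ = _ := by rw [← Finset.mul_sum]; rfl
  rw [bergmanBall, mem_ofPred_eq, key, mem_unitBall, dotProduct_star_self]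
  norm_cast
  have : (0 : ℝ) < n + 1 := by positivity
  constructor <;> intro h <;> push_cast at * <;> nlinarith

end BallModel

/-! ### Derivative bounds, extension to the closed ball, and the boundary -/

section Boundary

variable {n : ℕ} {F G : (Fin n → ℂ) → (Fin n → ℂ)} {Ω U : Set (Fin n → ℂ)}

theorem isBiholomorphism_normalize (a : Fin n → ℂ) {r : ℝ} (hr : 0 < r) :
    IsBiholomorphism (fun z => (r : ℂ)⁻¹ • (z - a)) (fun w => (r : ℂ) • w + a)
      (euclideanBall a r) (euclideanBall 0 1) := by
  have hr0 : (r : ℂ) ≠ 0 := by exact_mod_cast hr.ne'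
  refine ⟨fun z hz => ?_, fun w hw => ?_, ⟨fun z _ => ?_, fun w _ => ?_⟩, by fun_prop, by fun_prop⟩
  · rw [mem_unitBall]
    have hz' : ∑ i, ‖z i - a i‖ ^ 2 < r ^ 2 := hz
    simp only [Pi.smul_apply, Pi.sub_apply, smul_eq_mul, norm_mul, mul_pow, ← Finset.mul_sum]
    rw [norm_inv, Complex.norm_real, Real.norm_of_nonneg hr.le, inv_pow,
      inv_mul_lt_iff₀ (by positivity), mul_one]
    exact hz'
  · rw [mem_unitBall] at hw
    change ∑ i, ‖((r : ℂ) • w + a) i - a i‖ ^ 2 < r ^ 2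
    simp only [Pi.add_apply, Pi.smul_apply, add_sub_cancel_right, smul_eq_mul, norm_mul, mul_pow,
      ← Finset.mul_sum, Complex.norm_real, Real.norm_of_nonneg hr.le]
    exact mul_lt_of_lt_one_right (by positivity) hw
  · simp [smul_smul, hr0]
  · simp only [add_sub_cancel_right, smul_smul, inv_mul_cancel₀ hr0, one_smul]

theorem exists_isBiholomorphism_unitBall {a : Fin n → ℂ} {r : ℝ} (hr : 0 < r)
    (h : IsBiholomorphism F G Ω (euclideanBall a r)) {p : Fin n → ℂ} (hp : p ∈ Ω) :
    ∃ F' G', IsBiholomorphism F' G' Ω (euclideanBall 0 1) ∧ F' p = 0 := by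
  have h1 := h.trans (isBiholomorphism_normalize a hr)
  exact ⟨_, _, h1.trans (isBiholomorphism_ballInvolution (h1.mapsTo hp)),
    ballInvolution_self (h1.mapsTo hp)⟩

theorem norm_toLp_sq (z : Fin n → ℂ) : ‖WithLp.toLp 2 z‖ ^ 2 = ∑ i, ‖z i‖ ^ 2 := by
  rw [EuclideanSpace.norm_eq, Real.sq_sqrt (by positivity)]

theorem convex_unitBall : Convex ℝ (euclideanBall (0 : Fin n → ℂ) 1) := by
  have h := (convex_ball (0 : EuclideanSpace ℂ (Fin n)) 1).linear_preimage
    ((WithLp.linearEquiv 2 ℝ (Fin n → ℂ)).symm : (Fin n → ℂ) →ₗ[ℝ] EuclideanSpace ℂ (Fin n))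
  have e : euclideanBall (0 : Fin n → ℂ) 1 = WithLp.toLp 2 ⁻¹'
      ball (0 : EuclideanSpace ℂ (Fin n)) 1 := by
    ext z
    rw [mem_unitBall, ← norm_toLp_sq, sq_lt_one_iff₀ (norm_nonneg _), mem_preimage,
      mem_ball_zero_iff]
  rw [e]
  exact h

/-- A matrix with bounded entries and determinant bounded below has a bounded inverse. -/
theorem norm_inv_apply_le {A : Matrix (Fin n) (Fin n) ℂ} {M c : ℝ} (hM : 1 ≤ M) (hc : 0 < c)
    (hA : ∀ i j, ‖A i j‖ ≤ M) (hdet : c ≤ ‖A.det‖) (i j : Fin n) :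
    ‖A⁻¹ i j‖ ≤ c⁻¹ * (n.factorial * M ^ n) := by
  rw [Matrix.inv_def, Matrix.smul_apply, smul_eq_mul, norm_mul, Ring.inverse_eq_inv', norm_inv]
  have h1 : ‖A.adjugate i j‖ ≤ n.factorial * M ^ n := by
    -- An adjugate entry is the determinant of `A` with one row replaced by a unit vector; `1 ≤ M`
    -- keeps the entry bound valid for that row.
    rw [Matrix.adjugate_apply]
    have := Matrix.det_le (A := A.updateRow j (Pi.single i 1))
      (abv := NormedField.toAbsoluteValue ℂ) (x := M) fun k l => ?_
    · simpa [NormedField.toAbsoluteValue] using this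
    · simp only [NormedField.toAbsoluteValue, AbsoluteValue.coe_mk, MulHom.coe_mk]
      rw [Matrix.updateRow_apply]
      split_ifs
      · rw [Pi.single_apply]
        split_ifs <;> simp <;> linarith
      · exact hA k l
  exact mul_le_mul (inv_anti₀ hc hdet) h1 (norm_nonneg _) (by positivity)

/-- The first derivatives of the biholomorphism are bounded if the logarithmic derivatives of the
Bergman kernel are. -/
theorem IsBiholomorphism.exists_norm_fderiv_le (h : IsBiholomorphism F G Ω (euclideanBall 0 1))
    (hΩ : IsOpen Ω) (hB : ConditionB Ω U) {p : Fin n → ℂ} (hp : p ∈ U) (hFp : F p = 0) :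
    ∃ M : ℝ, ∀ z ∈ Ω, ∀ i j, ‖fderiv ℂ F z (Pi.single j 1) i‖ ≤ M := by
  obtain ⟨hU, -, hUΩ, C, hC, hCK⟩ := hB
  have hBo : IsOpen (euclideanBall (0 : Fin n → ℂ) 1) := isOpen_euclideanBall 0 1
  have hlog : ∀ j, ∀ z ∈ Ω, ∀ t ∈ U,
      ‖fderiv ℂ (complexJacobian F) z (Pi.single j 1) / complexJacobian F z +
        (n + 1) * (fderiv ℂ F z (Pi.single j 1) ⬝ᵥ star (F t)) / (1 - F z ⬝ᵥ star (F t))‖ ≤ C :=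
    fun j z hz t ht => by
    have h1 := h.fderiv_bergmanKernel hΩ hz (hUΩ ht) (Pi.single j 1)
    have h2 := hCK j z hz t ht
    rw [(h1.1.hasWirtinger (j := j)).1.wirtinger_eq, h1.2, norm_mul, mul_comm] at h2
    exact le_of_mul_le_mul_right h2 (norm_pos_iff.2 (h.bergmanKernel_ne_zero hΩ hz (hUΩ ht)))
  have hG0 : G 0 = p := by rw [← hFp]; exact h.invOn.1 (hUΩ hp)
  have hnhds : G ⁻¹' U ∩ euclideanBall 0 1 ∈ 𝓝 (0 : Fin n → ℂ) := by
    refine inter_mem ?_ (hBo.mem_nhds zero_mem_unitBall)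
    exact (h.holomorphic_inv.continuousOn.continuousAt (hBo.mem_nhds zero_mem_unitBall))
      (by rw [hG0]; exact hU.mem_nhds hp)
  obtain ⟨ε, hε, hball⟩ := Metric.mem_nhds_iff.1 hnhds
  -- The bounds at `p` and `G w` differ by at most `2C`. Multiplying by the denominator, at most
  -- `2`, gives `4C`, and dividing by `ε / 2` gives `8C / ε`; the factor `n + 1 ≥ 1` is dropped.
  refine ⟨8 * C / ε, fun z hz k j => ?_⟩
  -- At `t = G w` the linear term is a multiple of the single derivative `∂_j F_k(z)`, while at `t =
  -- p` it vanishes.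
  set w : Fin n → ℂ := Pi.single k ((ε / 2 : ℝ) : ℂ) with hw
  have hwm : w ∈ G ⁻¹' U ∩ euclideanBall 0 1 := by
    refine hball ?_
    rw [mem_ball_zero_iff, hw, Pi.norm_single, Complex.norm_real, Real.norm_of_nonneg (by positivity)]
    linarith
  have hFw : F (G w) = w := h.invOn.2 hwm.2
  have h1 := hlog j z hz p hp
  have h2 := hlog j z hz (G w) hwm.1
  rw [hFp] at h1
  rw [hFw] at h2
  simp only [star_zero, dotProduct_zero, mul_zero, zero_div, add_zero] at h1
  have hdot : fderiv ℂ F z (Pi.single j 1) ⬝ᵥ star w =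
      fderiv ℂ F z (Pi.single j 1) k * ((ε / 2 : ℝ) : ℂ) := by
    rw [hw, ← Pi.single_star, dotProduct_single, Complex.star_def, Complex.conj_ofReal]
  have hD := norm_dotProduct_star_lt_one (h.mapsTo hz) hwm.2
  have hD0 := norm_pos_iff.2 (one_sub_dotProduct_star_ne_zero (h.mapsTo hz) hwm.2)
  have hD2 : ‖1 - F z ⬝ᵥ star w‖ ≤ 2 := by
    refine (norm_sub_le _ _).trans ?_
    rw [norm_one]; linarith
  rw [hdot] at h2
  have h3 : ‖((n : ℂ) + 1) * (fderiv ℂ F z (Pi.single j 1) k * ((ε / 2 : ℝ) : ℂ)) /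
      (1 - F z ⬝ᵥ star w)‖ ≤ 2 * C := by
    have := norm_sub_le_of_le h2 h1
    rw [add_sub_cancel_left] at this
    linarith
  have hn1 : ‖(n : ℂ) + 1‖ = n + 1 := by
    exact_mod_cast Complex.norm_natCast (n + 1)
  rw [norm_div, norm_mul, norm_mul, hn1, Complex.norm_real, Real.norm_of_nonneg (by positivity),
    div_le_iff₀ hD0] at h3
  rw [le_div_iff₀ hε]
  have hx := norm_nonneg (fderiv ℂ F z (Pi.single j 1) k)
  have h4 : 2 * C * ‖1 - F z ⬝ᵥ star w‖ ≤ 4 * C := by nlinarith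
  have h5 : 0 ≤ (n : ℝ) * (‖fderiv ℂ F z (Pi.single j 1) k‖ * (ε / 2)) := by positivity
  linarith

/-- As `F p = 0`, `|K(z, p)| = |J(z)| |J(p)| / V`, so the lower bound on `K` bounds the Jacobian
below. With the upper bound on `F'` this bounds the inverse matrix `G'`, and convexity of the ball
turns the bound into a Lipschitz constant. -/
theorem IsBiholomorphism.exists_lipschitzOnWith_inv
    (h : IsBiholomorphism F G Ω (euclideanBall 0 1)) (hΩ : IsOpen Ω) (hB : ConditionB Ω U)
    (hlower : ∃ C : ℝ, 0 < C ∧ ∀ z ∈ Ω, ∀ p ∈ U, C ≤ ‖bergmanKernel Ω z p‖)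
    {p : Fin n → ℂ} (hp : p ∈ U) (hFp : F p = 0) :
    ∃ K, LipschitzOnWith K G (euclideanBall 0 1) := by
  have hBo : IsOpen (euclideanBall (0 : Fin n → ℂ) 1) := isOpen_euclideanBall 0 1
  obtain ⟨M, hM⟩ := h.exists_norm_fderiv_le hΩ hB hp hFp
  obtain ⟨C, hC, hCK⟩ := hlower
  have hpΩ : p ∈ Ω := hB.2.2.1 hp
  have hV := volume_real_unitBall_pos (n := n)
  have hJp := norm_pos_iff.2 (h.complexJacobian_ne_zero hΩ hBo hpΩ)
  set c := C * volume.real (euclideanBall (0 : Fin n → ℂ) 1) / ‖complexJacobian F p‖ with hc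
  have hc0 : 0 < c := by positivity
  have hJ : ∀ z ∈ Ω, c ≤ ‖complexJacobian F z‖ := fun z hz => by
    have h1 := hCK z hz p hp
    rw [h.bergmanKernel_eq hΩ hz hpΩ, hFp] at h1
    simp only [star_zero, dotProduct_zero, sub_zero, one_pow, inv_one, mul_one, norm_mul, norm_inv,
      Complex.norm_real, Real.norm_of_nonneg hV.le, RCLike.norm_conj] at h1
    rw [hc, div_le_iff₀ hJp]
    rw [mul_assoc, inv_mul_eq_div, le_div_iff₀ hV] at h1
    exact h1
  set R := c⁻¹ * (n.factorial * (max M 1) ^ n) with hR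
  have hR0 : 0 ≤ R := by positivity
  have hbound : ∀ w ∈ euclideanBall (0 : Fin n → ℂ) 1, ‖fderiv ℂ G w‖ ≤ n * R := fun w hw => by
    set z := G w with hz
    have hzΩ : z ∈ Ω := h.mapsTo_inv hw
    have hFz : F z = w := h.invOn.2 hw
    set A := LinearMap.toMatrix' (fderiv ℂ F z : (Fin n → ℂ) →ₗ[ℂ] (Fin n → ℂ)) with hA
    set B := LinearMap.toMatrix' (fderiv ℂ G w : (Fin n → ℂ) →ₗ[ℂ] (Fin n → ℂ)) with hBm
    have hBA : B * A = 1 := by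
      have h1 := h.fderiv_comp_fderiv hΩ hBo hzΩ
      rw [hFz] at h1
      rw [hA, hBm, ← LinearMap.toMatrix'_comp, ← ContinuousLinearMap.toLinearMap_comp, h1]
      exact LinearMap.toMatrix'_id
    have hAdet : A.det = complexJacobian F z := LinearMap.det_toMatrix' _
    have hBe : ∀ i j, ‖B i j‖ ≤ R := fun i j => by
      rw [← Matrix.inv_eq_left_inv hBA]
      have hAe : ∀ i j, ‖A i j‖ ≤ max M 1 := fun i j => (hM z hzΩ i j).trans (le_max_left M 1)
      exact norm_inv_apply_le (le_max_right M 1) hc0 hAe (hAdet ▸ hJ z hzΩ) i j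
    refine ContinuousLinearMap.opNorm_le_bound _ (by positivity) fun v => ?_
    have hBv : fderiv ℂ G w v = B.mulVec v := by
      rw [hBm, LinearMap.toMatrix'_mulVec]; rfl
    rw [hBv, pi_norm_le_iff_of_nonneg (by positivity)]
    intro i
    calc ‖B.mulVec v i‖ ≤ ∑ j, ‖B i j * v j‖ := by
          rw [Matrix.mulVec, dotProduct]; exact norm_sum_le _ _
      _ ≤ ∑ _j : Fin n, R * ‖v‖ := Finset.sum_le_sum fun j _ => by
          rw [norm_mul]
          exact mul_le_mul (hBe i j) (norm_le_pi_norm v j) (norm_nonneg _) hR0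
      _ = n * R * ‖v‖ := by simp; ring
  refine ⟨⟨n * R, by positivity⟩, ?_⟩
  refine Convex.lipschitzOnWith_of_nnnorm_fderiv_le (𝕜 := ℂ) (fun w hw =>
    h.holomorphic_inv.differentiableAt (hBo.mem_nhds hw)) (fun w hw => ?_) convex_unitBall
  exact hbound w hw

theorem mem_closure_unitBall {x : Fin n → ℂ} (hx : ∑ i, ‖x i‖ ^ 2 ≤ 1) :
    x ∈ closure (euclideanBall 0 1) := by
  have h1 : Tendsto (fun s : ℝ => (s : ℂ) • x) (𝓝[<] 1) (𝓝 x) := by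
    have : Continuous fun s : ℝ => (s : ℂ) • x := by fun_prop
    have h2 := this.tendsto 1
    simp only [Complex.ofReal_one, one_smul] at h2
    exact h2.mono_left nhdsWithin_le_nhds
  refine mem_closure_of_tendsto h1 ?_
  filter_upwards [Ioo_mem_nhdsLT (zero_lt_one' ℝ)] with s hs
  rw [mem_unitBall]
  simp only [Pi.smul_apply, smul_eq_mul, norm_mul, mul_pow, ← Finset.mul_sum, Complex.norm_real,
    Real.norm_of_nonneg hs.1.le]
  have h3 : s ^ 2 < 1 := by nlinarith [hs.1, hs.2]
  have h4 : 0 ≤ ∑ i, ‖x i‖ ^ 2 := by positivity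
  nlinarith

/-- The unit sphere of a real space of dimension `2n` is a manifold modelled on dimension `2n - 1`;
`1 ≤ n` makes this subtraction genuine. -/
theorem locallyConnectedSpace_sphere (hn : 1 ≤ n) :
    LocallyConnectedSpace (sphere (0 : EuclideanSpace ℂ (Fin n)) 1) := by
  have : Fact (Module.finrank ℝ (EuclideanSpace ℂ (Fin n)) = (2 * n - 1) + 1) := ⟨by
    rw [finrank_real_of_complex, finrank_euclideanSpace_fin]; omega⟩
  exact ChartedSpace.locallyConnectedSpace (EuclideanSpace ℝ (Fin (2 * n - 1))) _

/-- If the inverse of a biholomorphism onto the unit ball extends continuously to the closed ball,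
then the boundary is a continuous image of the sphere, hence locally connected. -/
theorem IsBiholomorphism.locallyConnectedSpace_frontier (hn : 1 ≤ n)
    (h : IsBiholomorphism F G Ω (euclideanBall 0 1)) (hΩ : IsOpen Ω)
    {H : (Fin n → ℂ) → (Fin n → ℂ)} (hH : Continuous H) (hHG : EqOn G H (euclideanBall 0 1)) :
    LocallyConnectedSpace (frontier Ω) := by
  have := locallyConnectedSpace_sphere hn
  have hmaps : MapsTo H (euclideanBall 0 1) Ω := fun w hw => hHG hw ▸ h.mapsTo_inv hw
  -- If `H x` lay in `Ω`, then `F ∘ H`, the identity on the open ball, would give `F (H x) = x` in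
  -- the limit, but `x` is on the sphere and `F` takes values in the open ball.
  have hfr : ∀ x : sphere (0 : EuclideanSpace ℂ (Fin n)) 1, H x.1.ofLp ∈ frontier Ω := fun x => by
    have hx : ∑ i, ‖x.1.ofLp i‖ ^ 2 = 1 := by
      rw [← norm_toLp_sq, WithLp.toLp_ofLp, mem_sphere_zero_iff_norm.1 x.2, one_pow]
    have hcl := mem_closure_unitBall hx.le
    rw [hΩ.frontier_eq]
    refine ⟨map_mem_closure hH hcl hmaps, fun hmem => ?_⟩
    have hne : (𝓝[euclideanBall 0 1] x.1.ofLp).NeBot := mem_closure_iff_nhdsWithin_neBot.1 hcl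
    have h1 : Tendsto (fun w => F (H w)) (𝓝[euclideanBall 0 1] x.1.ofLp)
        (𝓝 (F (H x.1.ofLp))) :=
      ((h.holomorphic.continuousOn.continuousAt (hΩ.mem_nhds hmem)).comp
        hH.continuousAt).tendsto.mono_left nhdsWithin_le_nhds
    have h2 : Tendsto (fun w => F (H w)) (𝓝[euclideanBall 0 1] x.1.ofLp) (𝓝 x.1.ofLp) := by
      refine (tendsto_id.mono_left nhdsWithin_le_nhds).congr' ?_
      filter_upwards [self_mem_nhdsWithin] with w hw
      rw [← hHG hw, h.invOn.2 hw, id]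
    have h3 := h.mapsTo hmem
    rw [tendsto_nhds_unique h1 h2, mem_unitBall, hx] at h3
    exact lt_irrefl _ h3
  let φ : sphere (0 : EuclideanSpace ℂ (Fin n)) 1 → frontier Ω := fun x => ⟨H x.1.ofLp, hfr x⟩
  have hφ : Continuous φ :=
    (hH.comp ((PiLp.continuous_ofLp 2 _).comp continuous_subtype_val)).subtype_mk hfr
  -- The image of the closed ball is compact and contains `Ω`, hence its closure. A preimage of a
  -- frontier point cannot be in the open ball, which `H` maps into `Ω`.
  have hsurj : Function.Surjective φ := by
    rintro ⟨y, hy⟩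
    rw [hΩ.frontier_eq] at hy
    have hcomp : IsCompact (H '' (WithLp.ofLp ''
        closedBall (0 : EuclideanSpace ℂ (Fin n)) 1)) :=
      ((isCompact_closedBall _ _).image (PiLp.continuous_ofLp 2 _)).image hH
    have hsub : Ω ⊆ H '' (WithLp.ofLp '' closedBall (0 : EuclideanSpace ℂ (Fin n)) 1) :=
      fun z hz => by
      refine ⟨F z, ⟨WithLp.toLp 2 (F z), ?_, rfl⟩, ?_⟩
      · rw [mem_closedBall_zero_iff, ← sq_le_one_iff₀ (norm_nonneg _), norm_toLp_sq]
        exact (mem_unitBall.1 (h.mapsTo hz)).le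
      · rw [← hHG (h.mapsTo hz), h.invOn.1 hz]
    obtain ⟨_, ⟨x, hx, rfl⟩, rfl⟩ := closure_minimal hsub hcomp.isClosed hy.1
    rw [mem_closedBall_zero_iff] at hx
    refine ⟨⟨x, ?_⟩, rfl⟩
    rw [mem_sphere_zero_iff_norm]
    refine hx.eq_of_not_lt fun hlt => hy.2 (hmaps ?_)
    rw [mem_unitBall, ← norm_toLp_sq, WithLp.toLp_ofLp]
    exact (sq_lt_one_iff₀ (norm_nonneg _)).2 hlt
  -- A continuous surjection from a compact space onto a Hausdorff space is closed, hence a quotient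
  -- map.
  exact (hφ.isClosedMap.isQuotientMap hφ hsurj).locallyConnectedSpace

end Boundary

/-! ### The main theorem -/

theorem mainTheorem4 {n : ℕ} (hn : 1 ≤ n) (Ω U : Set (Fin n → ℂ))
    (hopen : IsOpen Ω) (hconn : IsConnected Ω) (hbdd : Bornology.IsBounded Ω)
    (hball : ∃ (a : Fin n → ℂ) (r : ℝ), 0 < r ∧
      ∃ F G : (Fin n → ℂ) → (Fin n → ℂ), IsBiholomorphism F G Ω (euclideanBall a r))
    (hB : ConditionB Ω U)
    (hlower : ∃ C : ℝ, 0 < C ∧ ∀ z ∈ Ω, ∀ p ∈ U, C ≤ ‖bergmanKernel Ω z p‖) :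
    (∀ p ∈ U, ∃ S : (Fin n → ℂ) → (Fin n → ℂ),
      IsBiholomorphism (bergmanRep Ω p) S Ω (bergmanBall Ω p) ∧
      ContinuousOn S (closure (bergmanBall Ω p))) ∧
    LocallyConnectedSpace (frontier Ω) := by
  obtain ⟨a, r, hr, F₀, G₀, h₀⟩ := hball
  have hBo : IsOpen (euclideanBall (0 : Fin n → ℂ) 1) := isOpen_euclideanBall 0 1
  have hUΩ : U ⊆ Ω := hB.2.2.1
  have hext : ∀ p ∈ U, ∃ F G H : (Fin n → ℂ) → (Fin n → ℂ),
      IsBiholomorphism F G Ω (euclideanBall 0 1) ∧ F p = 0 ∧ Continuous H ∧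
      EqOn G H (euclideanBall 0 1) := fun p hp => by
    obtain ⟨F, G, h, hFp⟩ := exists_isBiholomorphism_unitBall hr h₀ (hUΩ hp)
    obtain ⟨K, hK⟩ := h.exists_lipschitzOnWith_inv hopen hB hlower hp hFp
    -- The Lipschitz map extends to the whole space, so `H` is continuous everywhere and not only on
    -- the closed ball.
    obtain ⟨H, hH, hGH⟩ := hK.extend_finite_dimension
    exact ⟨F, G, H, h, hFp, hH.continuous, hGH⟩
  refine ⟨fun p hp => ?_, ?_⟩
  · obtain ⟨F, G, H, h, hFp, hH, hGH⟩ := hext p hp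
    have hpΩ := hUΩ hp
    have hG0 : G 0 = p := by rw [← hFp]; exact h.invOn.1 hpΩ
    have hGF : ∀ v, fderiv ℂ G 0 (fderiv ℂ F p v) = v := fun v => by
      have := h.fderiv_comp_fderiv hopen hBo hpΩ
      rw [hFp] at this
      exact congrArg (fun L : (Fin n → ℂ) →L[ℂ] (Fin n → ℂ) => L v) this
    have hFG : ∀ v, fderiv ℂ F p (fderiv ℂ G 0 v) = v := fun v => by
      have := h.symm.fderiv_comp_fderiv hBo hopen zero_mem_unitBall
      rw [hG0] at this
      exact congrArg (fun L : (Fin n → ℂ) →L[ℂ] (Fin n → ℂ) => L v) this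
    have hlin : IsBiholomorphism (fderiv ℂ G 0) (fderiv ℂ F p)
        (euclideanBall 0 1) (bergmanBall Ω p) :=
      ⟨fun w hw => by rw [h.mem_bergmanBall hopen hpΩ hFp, hFG]; exact hw,
        fun w hw => (h.mem_bergmanBall hopen hpΩ hFp w).1 hw,
        ⟨fun w _ => hFG w, fun w _ => hGF w⟩,
        (fderiv ℂ G 0).differentiable.differentiableOn,
        (fderiv ℂ F p).differentiable.differentiableOn⟩
    have hcomp := h.trans hlin
    have hrep : EqOn (bergmanRep Ω p) (fderiv ℂ G 0 ∘ F) Ω := fun z hz =>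
      h.bergmanRep_eq hopen hpΩ hFp hz
    have hS : EqOn (G ∘ fderiv ℂ F p) (H ∘ fderiv ℂ F p) (bergmanBall Ω p) := fun w hw =>
      hGH (hlin.mapsTo_inv hw)
    -- The inverse is taken as `H ∘ F'(p)`, not `G ∘ F'(p)`: both agree on the ball of the metric,
    -- but only the former is known to be continuous up to its closure.
    refine ⟨H ∘ fderiv ℂ F p, ⟨hcomp.mapsTo.congr hrep.symm, hcomp.mapsTo_inv.congr hS,
      ⟨fun z hz => ?_, fun w hw => ?_⟩, hcomp.holomorphic.congr hrep,
      hcomp.holomorphic_inv.congr hS.symm⟩, (hH.comp (fderiv ℂ F p).continuous).continuousOn⟩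
    · rw [hrep hz, ← hS (hcomp.mapsTo hz)]
      exact hcomp.invOn.1 hz
    · rw [← hS hw, hrep (hcomp.mapsTo_inv hw)]
      exact hcomp.invOn.2 hw
  · obtain ⟨p, hp⟩ := hB.2.1
    obtain ⟨F, G, H, h, hFp, hH, hGH⟩ := hext p hp
    exact h.locallyConnectedSpace_frontier hn hopen hH hGH
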